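/- Let $\Bbbk$ be a field of characteristic $2$ and let $X=\{1,2\}$. Let $\mathfrak G$ be the Grigorchuk group, that is, the group of transformations of the set $X^\omega$ of infinite words over $X$ generated by $a,b,c,d$, where $a$ exchanges the two possible values of the first letter and leaves the other letters unchanged and, for every $w\in X^\omega$, $$b(1w)=1\,a(w),\quad b(2w)=2\,c(w),\qquad c(1w)=1\,a(w),\quad c(2w)=2\,d(w),\qquad d(1w)=1\,w,\quad d(2w)=2\,b(w).$$ Let $\mathcal A$ be its tree enveloping algebra, i.e. the image of the group algebra $\Bbbk\mathfrak G$ in $\operatorname{End}_{\Bbbk}(\Bbbk X^\omega)$, where $\Bbbk X^\omega$ is the vector space with basis $X^\omega$. In $\mathcal A$ set $A=a-1$, $B=b-1$, $C=c-1$, $D=d-1$ and $S=\{A,B,C,D\}$. Let $$\mathcal R_0=\{A^2,B^2,C^2,D^2,\;B+C+D,\;BC,CB,BD,DB,CD,DC,\;DAD\},$$ and let $\sigma:S^*\to S^*$ be the substitution on words $A\mapsto ACA$, $B\mapsto D$, $C\mapsto B$, $D\mapsto C$. 1. As an associative algebra with unit, $\mathcal A$ admits, on the generators $A,B,C,D$,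 the presentation $$\mathcal A=\big\langle A,B,C,D\ \big|\ \mathcal R_0,\ \sigma^n(CACACAC),\ \sigma^n(DACACAD)\text{ for all }n\ge0\big\rangle .$$ This presentation is recursive: the set of words $\{\sigma^n(CACACAC),\sigma^n(DACACAD): n\ge0\}$ is decidable. 2. Consequently $\mathcal A$ is graded along the powers of its augmentation ideal $\varpi$ (the kernel of the algebra homomorphism $\mathcal A\to\Bbbk$ that sends every $g\in\mathfrak G$ to $1$), and this grading is the one defined by the generating set $S$. That is, if $\mathcal A_n$ denotes the $\Bbbk$-span of the elements of $\mathcal A$ represented by words of length $n$ over $S$, then $\mathcal A=\bigoplus_{n\ge0}\mathcal A_n$, $1\in\mathcal A_0$, $\mathcal A_i\mathcal A_j\subseteq\mathcal A_{i+j}$, and $\varpi^n=\bigoplus_{m\ge n}\mathcal A_m$ for all $n\ge0$. -/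

import Mathlib

noncomputable section

/-! ## Tree enveloping algebras -/

/-- The boundary `X^ω` of the binary tree `X^*`, where `X = {1, 2}`; the letter `1` is encoded as
`false` and the letter `2` as `true`. -/
abbrev Boundary : Type := ℕ → Bool

/-- The vector space `k X^ω` with basis `X^ω`. -/
def BoundarySpace (k : Type*) [Field k] : Type _ := Boundary →₀ k

namespace BoundarySpace

instance (k : Type*) [Field k] : AddCommGroup (BoundarySpace k) :=
  inferInstanceAs (AddCommGroup (Boundary →₀ k))

instance (k : Type*) [Field k] : Module k (BoundarySpace k) :=
  inferInstanceAs (Module k (Boundary →₀ k))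

/-- The basis `X^ω` of `k X^ω`. -/
def basis (k : Type*) [Field k] : Module.Basis Boundary k (BoundarySpace k) :=
  Module.Basis.ofRepr (LinearEquiv.refl k (Boundary →₀ k))

end BoundarySpace

/-- The permutation representation on `k X^ω` of a group `G` of permutations of `X^ω`. -/
def boundaryRep (k : Type*) [Field k] (G : Subgroup (Equiv.Perm Boundary)) :
    Representation k G (BoundarySpace k) where
  toFun g := (BoundarySpace.basis k).constr k
    (fun ξ => BoundarySpace.basis k ((g : Equiv.Perm Boundary) ξ))
  map_one' := (BoundarySpace.basis k).ext fun ξ => by simp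
  map_mul' g h := (BoundarySpace.basis k).ext fun ξ => by simp

theorem boundaryRep_basis (k : Type*) [Field k] (G : Subgroup (Equiv.Perm Boundary)) (g : G)
    (ξ : Boundary) : boundaryRep k G g (BoundarySpace.basis k ξ) =
      BoundarySpace.basis k ((g : Equiv.Perm Boundary) ξ) := by
  simp [boundaryRep]

/-- The tree enveloping algebra over `k` of a group `G` of permutations of `X^ω`: the image of the
group algebra `k[G]` in `End (k X^ω)`. -/
def treeEnvelopingAlgebra (k : Type*) [Field k] (G : Subgroup (Equiv.Perm Boundary)) :
    Subalgebra k (Module.End k (BoundarySpace k)) :=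
  (boundaryRep k G).asAlgebraHom.range

/-- The image in the tree enveloping algebra of an element of `G`. -/
def treeEnvelopingAlgebra.of (k : Type*) [Field k] (G : Subgroup (Equiv.Perm Boundary)) (g : G) :
    treeEnvelopingAlgebra k G :=
  ⟨boundaryRep k G g, MonoidAlgebra.of k G g, Representation.asAlgebraHom_of _ g⟩

/-- The sum of the coordinates of a vector of `k X^ω`. -/
def coordSum (k : Type*) [Field k] : BoundarySpace k →ₗ[k] k :=
  (BoundarySpace.basis k).constr k (fun _ => (1 : k))

theorem coordSum_basis (k : Type*) [Field k] (ξ : Boundary) :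
    coordSum k (BoundarySpace.basis k ξ) = 1 := by
  simp [coordSum]

theorem coordSum_apply_of_mem {k : Type*} [Field k] {G : Subgroup (Equiv.Perm Boundary)}
    {T : Module.End k (BoundarySpace k)} (hT : T ∈ treeEnvelopingAlgebra k G)
    (v : BoundarySpace k) :
    coordSum k (T v) = coordSum k (T (BoundarySpace.basis k fun _ => false)) * coordSum k v := by
  suffices h : ∃ c : k, coordSum k ∘ₗ T = c • coordSum k by
    obtain ⟨c, hc⟩ := h
    have hc' : ∀ v, coordSum k (T v) = c * coordSum k v := fun v => LinearMap.congr_fun hc v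
    rw [hc' v, hc' (BoundarySpace.basis k _), coordSum_basis, mul_one]
  obtain ⟨f, rfl⟩ := hT
  induction f using MonoidAlgebra.induction_on with
  | of g =>
    refine ⟨1, (BoundarySpace.basis k).ext fun ξ => ?_⟩
    simp [boundaryRep_basis, coordSum_basis]
  | add f g hf hg =>
    obtain ⟨c, hc⟩ := hf
    obtain ⟨d, hd⟩ := hg
    refine ⟨c + d, ?_⟩
    rw [add_smul, ← hc, ← hd, ← LinearMap.comp_add]
    congr 1
    exact map_add (boundaryRep k G).asAlgebraHom f g
  | smul r f hf =>
    obtain ⟨c, hc⟩ := hf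
    refine ⟨r * c, ?_⟩
    rw [mul_smul, ← hc, ← LinearMap.comp_smul]
    congr 1
    exact map_smul (boundaryRep k G).asAlgebraHom r f

/-- The augmentation of the tree enveloping algebra, i.e. the algebra homomorphism to `k` that
sends every element of the group `G` to `1` (see `augmentation_of`). -/
def augmentation (k : Type*) [Field k] (G : Subgroup (Equiv.Perm Boundary)) :
    treeEnvelopingAlgebra k G →ₐ[k] k :=
  AlgHom.ofLinearMap
    ((coordSum k ∘ₗ LinearMap.applyₗ (BoundarySpace.basis k fun _ => false)) ∘ₗ
      (treeEnvelopingAlgebra k G).val.toLinearMap)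
    (by simp [coordSum_basis])
    (fun x y => by
      have h := coordSum_apply_of_mem x.2 ((y : Module.End k (BoundarySpace k))
        (BoundarySpace.basis k fun _ => false))
      simpa using h)

theorem augmentation_of (k : Type*) [Field k] (G : Subgroup (Equiv.Perm Boundary)) (g : G) :
    augmentation k G (treeEnvelopingAlgebra.of k G g) = 1 := by
  simp [augmentation, treeEnvelopingAlgebra.of, coordSum_basis, boundaryRep_basis]

/-- The augmentation ideal `ϖ`, the kernel of the augmentation. -/
def augmentationIdeal (k : Type*) [Field k] (G : Subgroup (Equiv.Perm Boundary)) :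
    Ideal (treeEnvelopingAlgebra k G) :=
  RingHom.ker (augmentation k G)

/-! ## The Grigorchuk group -/

namespace Grigorchuk

/-- The states of the automaton defining the group: the identity `e` and the generators. -/
inductive State : Type
  | e | a | b | c | d

/-- The activity of a state on the first letter: `a` exchanges the two letters, the other states
fix them. -/
def State.activity : State → Bool → Bool
  | .a, x => !x
  | _, x => x

/-- The decomposition `a = ⟨1, 1⟩ (1,2)`, `b = ⟨a, c⟩`, `c = ⟨a, d⟩`, `d = ⟨1, b⟩`: the state which
acts on the remaining letters after the given first letter. -/
def State.decomp : State → Bool → State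
  | .b, false => .a
  | .b, true => .c
  | .c, false => .a
  | .c, true => .d
  | .d, true => .b
  | _, _ => .e

/-- The action of a state on infinite words: the first letter is changed by the activity, the
remaining word by the state given by the decomposition. -/
def State.act : State → Boundary → Boundary
  | s, ξ, 0 => s.activity (ξ 0)
  | s, ξ, n + 1 => State.act (s.decomp (ξ 0)) (fun m => ξ (m + 1)) n

theorem State.act_act (s : State) (ξ : Boundary) : s.act (s.act ξ) = ξ := by
  funext n
  induction n generalizing s ξ with
  | zero => cases s <;> simp [State.act, State.activity]
  | succ n ih =>
    have h : s.decomp (s.activity (ξ 0)) = s.decomp (ξ 0) := by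
      cases s <;> cases ξ 0 <;> rfl
    have h' : (fun m => s.act ξ (m + 1)) = (s.decomp (ξ 0)).act (fun m => ξ (m + 1)) := by
      funext m
      simp [State.act]
    have h0 : s.act ξ 0 = s.activity (ξ 0) := by simp [State.act]
    rw [State.act, h', h0, h, ih]

/-- The permutation of `X^ω` defined by a state. -/
def State.perm (s : State) : Equiv.Perm Boundary :=
  ⟨s.act, s.act, s.act_act, s.act_act⟩

/-- The four letters of the alphabet `S = {A, B, C, D}`. -/
inductive Letter : Type
  | A | B | C | D

/-- The element `a`, `b`, `c` or `d` with which a letter is associated. -/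
def Letter.state : Letter → State
  | .A => .a
  | .B => .b
  | .C => .c
  | .D => .d

/-- The Grigorchuk group, generated by `a`, `b`, `c`, `d`, as a group of permutations of `X^ω`. -/
def group : Subgroup (Equiv.Perm Boundary) :=
  Subgroup.closure (Set.range fun s : Letter => s.state.perm)

/-- The generators `a`, `b`, `c`, `d` as elements of the Grigorchuk group. -/
def groupGen (s : Letter) : group :=
  ⟨s.state.perm, Subgroup.subset_closure ⟨s, rfl⟩⟩

/-- The elements `A = a - 1`, `B = b - 1`, `C = c - 1`, `D = d - 1` of the tree enveloping algebra
of the Grigorchuk group. -/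
def gen (k : Type*) [Field k] (s : Letter) : treeEnvelopingAlgebra k group :=
  treeEnvelopingAlgebra.of k group (groupGen s) - 1

/-! ## The presentation -/

/-- The enumeration of the alphabet. -/
def Letter.equivFin : Letter ≃ Fin 4 where
  toFun
    | .A => 0
    | .B => 1
    | .C => 2
    | .D => 3
  invFun
    | 0 => .A
    | 1 => .B
    | 2 => .C
    | 3 => .D
  left_inv s := by cases s <;> rfl
  right_inv i := by fin_cases i <;> rfl

instance : Primcodable Letter := Primcodable.ofEquiv (Fin 4) Letter.equivFin

/-- The values of the substitution `σ` on letters: `A ↦ ACA`, `B ↦ D`, `C ↦ B`, `D ↦ C`. -/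
def sigmaLetter : Letter → List Letter
  | .A => [.A, .C, .A]
  | .B => [.D]
  | .C => [.B]
  | .D => [.C]

/-- The substitution `σ` on words over `S`. -/
def sigma (w : List Letter) : List Letter := w.flatMap sigmaLetter

open Letter in
/-- The words `σ^n(CACACAC)` and `σ^n(DACACAD)` for all `n ≥ 0`. -/
def sigmaRelators : Set (List Letter) :=
  {w | ∃ n : ℕ, w = sigma^[n] [C, A, C, A, C, A, C] ∨ w = sigma^[n] [D, A, C, A, C, A, D]}

/-- The element of the free associative algebra given by a word. -/
def monomial (k : Type*) [Field k] (w : List Letter) : FreeAlgebra k Letter :=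
  (w.map (FreeAlgebra.ι k)).prod

open Letter in
/-- `R₀ = {A², B², C², D², B + C + D, BC, CB, BD, DB, CD, DC, DAD}`. -/
def relators₀ (k : Type*) [Field k] : Set (FreeAlgebra k Letter) :=
  {monomial k [A, A], monomial k [B, B], monomial k [C, C], monomial k [D, D],
    monomial k [B] + monomial k [C] + monomial k [D],
    monomial k [B, C], monomial k [C, B], monomial k [B, D], monomial k [D, B],
    monomial k [C, D], monomial k [D, C], monomial k [D, A, D]}

/-- The set of all relators. -/
def relators (k : Type*) [Field k] : Set (FreeAlgebra k Letter) :=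
  relators₀ k ∪ monomial k '' sigmaRelators

/-- The associative unital `k`-algebra presented by the generators `S` and the relations `r = 0`,
for `r` in the set `R`. -/
abbrev Presented (k : Type*) [Field k] (R : Set (FreeAlgebra k Letter)) : Type _ :=
  RingQuot (fun x y : FreeAlgebra k Letter => x ∈ R ∧ y = 0)

/-- The image of a generator in the presented algebra. -/
def Presented.gen (k : Type*) [Field k] (R : Set (FreeAlgebra k Letter)) (s : Letter) :
    Presented k R :=
  RingQuot.mkAlgHom k (fun x y : FreeAlgebra k Letter => x ∈ R ∧ y = 0) (FreeAlgebra.ι k s)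

/-- The span of the words of length `n` over the generating set `{A, B, C, D}` of the tree
enveloping algebra. -/
def degreePart (k : Type*) [Field k] (n : ℕ) : Submodule k (treeEnvelopingAlgebra k group) :=
  Submodule.span k
    {x | ∃ w : List Letter, w.length = n ∧ x = (w.map (Grigorchuk.gen k)).prod}

end Grigorchuk

/-- The subspaces `M n` form a grading of the algebra `R`, and the powers of the ideal `I` are the
subspaces spanned by the components of large degree. -/
structure IsGradedAlongPowers {k R : Type*} [Field k] [Ring R] [Algebra k R]
    (M : ℕ → Submodule k R) (I : Ideal R) : Prop where
  one_mem : 1 ∈ M 0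
  mul_mem : ∀ (i j : ℕ) (x y : R), x ∈ M i → y ∈ M j → x * y ∈ M (i + j)
  isInternal : DirectSum.IsInternal M
  pow_eq : ∀ n : ℕ, (I ^ n).restrictScalars k = ⨆ m ≥ n, M m

end

/-! Sorting the basis words by their first letter turns operators on `k X^ω` into 2×2 matrices of
operators (`block`). In characteristic 2 the letter A becomes the matrix with all entries 1, while
B, C, D become diag(A, C), diag(A, D), diag(0, B). This map is injective, so identities can be
checked, and unravelled, one level further down the tree.

The relations hold because σ inverts the passage to the second branch: if w is an alternating word
with at least two letters A that begins and ends outside A, then σ(w) has matrix diag(0, w)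
(`altSpan_le_liftSubmodule`). Once w acts as zero, so does every σ^n(w), and only n = 0 needs a
computation.

The relations suffice by an induction on the number of letters A. Since σ(DAD) = CACAC is not zero
in the algebra, σ does not descend to the presented algebra; it does act on `Cover`, where DAD is
weakened to its products DADAx and xADAD. Eliminate B and take an alternating word in A, C, D with
at least two A's. No two D's are neighbours, and the relators CACACAC and DACACAD leave only runs of
one or three C's between consecutive D's. All D's therefore sit at positions of one parity, and up
to a C at either end the word is the image under σ of a word about half as long (`alt_le`,
`posSpan_succ_le`). In the matrix of such a sum the kinds of terms fall into different entries
(`block_of_mem_redSpan`), which yields by induction that words with and without an outer A are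
independent (`isSeparated_opSpan`) and that alternating words without DAD act faithfully
(`coverOp_eq_zero`). A normal form in `Cover` then gives `presentedOp_injective`.

The relators are homogeneous, so word length is a grading of the presented algebra and hence of the
enveloping algebra. The generators have augmentation zero, so the powers of the augmentation ideal
are spanned by the long words. -/

noncomputable section

namespace Grigorchuk

/-! ### Matrix decomposition along the first letter -/

variable {k : Type*} [Field k]

/-- The infinite word with a given first letter and given remaining letters. -/
def consWord (p : Bool) (ξ : Boundary) : Boundary
  | 0 => p
  | n + 1 => ξ n

theorem consWord_tail (ξ : Boundary) : consWord (ξ 0) (fun n => ξ (n + 1)) = ξ := by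
  funext n; cases n <;> rfl

variable (k) in
/-- The embedding of `k X^ω` as the span of the words with first letter `p`. -/
def branchIncl (p : Bool) : BoundarySpace k →ₗ[k] BoundarySpace k :=
  (BoundarySpace.basis k).constr k fun ξ => BoundarySpace.basis k (consWord p ξ)

variable (k) in
/-- The projection of `k X^ω` to the span of the words with first letter `p`. -/
def branchProj (p : Bool) : BoundarySpace k →ₗ[k] BoundarySpace k :=
  (BoundarySpace.basis k).constr k fun ξ =>
    if ξ 0 = p then BoundarySpace.basis k (fun n => ξ (n + 1)) else 0

theorem branchIncl_basis (p : Bool) (ξ : Boundary) :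
    branchIncl k p (BoundarySpace.basis k ξ) = BoundarySpace.basis k (consWord p ξ) := by
  simp [branchIncl]

theorem branchProj_basis (p q : Bool) (ξ : Boundary) :
    branchProj k p (BoundarySpace.basis k (consWord q ξ)) =
      if q = p then BoundarySpace.basis k ξ else 0 := by
  simp only [branchProj, Module.Basis.constr_basis]
  rfl

theorem branchProj_comp_incl (p q : Bool) :
    branchProj k p ∘ₗ branchIncl k q = if q = p then LinearMap.id else 0 := by
  refine (BoundarySpace.basis k).ext fun ξ => ?_
  rw [LinearMap.comp_apply, branchIncl_basis, branchProj_basis]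
  split_ifs <;> simp

theorem branchIncl_comp_proj_add :
    branchIncl k false ∘ₗ branchProj k false + branchIncl k true ∘ₗ branchProj k true =
      LinearMap.id := by
  refine (BoundarySpace.basis k).ext fun ξ => ?_
  rw [← consWord_tail ξ]
  cases ξ 0 <;>
    simp [branchProj_basis, branchIncl_basis]

/-- The index of a letter of the alphabet `{1, 2}`. -/
def letterOfFin (i : Fin 2) : Bool := i = 1

variable (k) in
/-- The matrix of an endomorphism of `k X^ω` with respect to the first letter. -/
def block : Module.End k (BoundarySpace k) →ₐ[k]
    Matrix (Fin 2) (Fin 2) (Module.End k (BoundarySpace k)) :=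
  AlgHom.ofLinearMap
    { toFun := fun T => Matrix.of fun i j =>
        branchProj k (letterOfFin i) ∘ₗ T ∘ₗ branchIncl k (letterOfFin j)
      map_add' := fun S T => by
        ext i j : 2
        simp [LinearMap.comp_add, LinearMap.add_comp]
      map_smul' := fun r T => by
        ext i j : 2
        simp [LinearMap.comp_smul, LinearMap.smul_comp] }
    (by
      refine Matrix.ext fun i j => ?_
      have h := branchProj_comp_incl (k := k) (letterOfFin i) (letterOfFin j)
      fin_cases i <;> fin_cases j <;> simpa [letterOfFin, Module.End.one_eq_id] using h)
    (fun S T => by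
      ext i j : 2
      have h : S ∘ₗ T = S ∘ₗ (branchIncl k false ∘ₗ branchProj k false +
          branchIncl k true ∘ₗ branchProj k true) ∘ₗ T := by
        rw [branchIncl_comp_proj_add, LinearMap.id_comp]
      simp only [LinearMap.coe_mk, AddHom.coe_mk, Matrix.of_apply, Matrix.mul_apply,
        Fin.sum_univ_two]
      rw [Module.End.mul_eq_comp, h]
      simp only [LinearMap.add_comp, LinearMap.comp_add, Module.End.mul_eq_comp,
        LinearMap.comp_assoc]
      rfl)

theorem block_apply (T : Module.End k (BoundarySpace k)) (i j : Fin 2) :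
    block k T i j = branchProj k (letterOfFin i) ∘ₗ T ∘ₗ branchIncl k (letterOfFin j) := rfl

theorem block_injective : Function.Injective (block k) := by
  rw [injective_iff_map_eq_zero]
  intro T hT
  have h : ∀ i j, branchProj k (letterOfFin i) ∘ₗ T ∘ₗ branchIncl k (letterOfFin j) = 0 :=
    fun i j => by rw [← block_apply, hT]; rfl
  have h00 := h 0 0
  have h01 := h 0 1
  have h10 := h 1 0
  have h11 := h 1 1
  simp only [letterOfFin] at h00 h01 h10 h11
  have e : T = (branchIncl k false ∘ₗ branchProj k false +
      branchIncl k true ∘ₗ branchProj k true) ∘ₗ T ∘ₗ (branchIncl k false ∘ₗ branchProj k false +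
      branchIncl k true ∘ₗ branchProj k true) := by
    simp only [branchIncl_comp_proj_add, LinearMap.id_comp, LinearMap.comp_id]
  rw [e]
  refine LinearMap.ext fun v => ?_
  have a00 := LinearMap.congr_fun h00
  have a01 := LinearMap.congr_fun h01
  have a10 := LinearMap.congr_fun h10
  have a11 := LinearMap.congr_fun h11
  simp at a00 a01 a10 a11
  simp [a00, a01, a10, a11]

/-! ### The generators as matrices and the relations R₀ -/

variable (k) in
/-- The endomorphism `s - 1` of `k X^ω`. -/
def op (s : Letter) : Module.End k (BoundarySpace k) := gen k s

theorem op_basis (s : Letter) (ξ : Boundary) :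
    op k s (BoundarySpace.basis k ξ) =
      BoundarySpace.basis k (s.state.act ξ) - BoundarySpace.basis k ξ := by
  simp only [op, gen, treeEnvelopingAlgebra.of, AddSubgroupClass.coe_sub, OneMemClass.coe_one,
    LinearMap.sub_apply, Module.End.one_apply, boundaryRep_basis]
  rfl

theorem act_consWord (s : State) (p : Bool) (ξ : Boundary) :
    s.act (consWord p ξ) = consWord (s.activity p) ((s.decomp p).act ξ) := by
  funext n
  cases n <;> simp [State.act, consWord]

theorem act_e (ξ : Boundary) : State.e.act ξ = ξ := by
  funext n
  induction n generalizing ξ with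
  | zero => simp [State.act, State.activity]
  | succ n ih => simp [State.act, State.decomp, ih]

theorem matrix_eq_of (M : Matrix (Fin 2) (Fin 2) (Module.End k (BoundarySpace k)))
    {a b c d : Module.End k (BoundarySpace k)} (h00 : M 0 0 = a) (h01 : M 0 1 = b)
    (h10 : M 1 0 = c) (h11 : M 1 1 = d) : M = !![a, b; c, d] := by
  refine Matrix.ext fun i j => ?_
  fin_cases i <;> fin_cases j <;> simpa

theorem add_self_of_two {M : Type*} [AddCommGroup M] [Module k M] [CharP k 2] (x : M) :
    x + x = 0 := by
  rw [← two_smul k, CharTwo.two_eq_zero, zero_smul]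

theorem neg_eq_of_two [CharP k 2] {M : Type*} [AddCommGroup M] [Module k M] (x : M) :
    -x = x := by
  rw [neg_eq_iff_add_eq_zero, add_self_of_two (k := k)]

theorem block_op_A [CharP k 2] : block k (op k .A) = !![1, 1; 1, 1] := by
  apply matrix_eq_of <;>
  · refine (BoundarySpace.basis k).ext fun ξ => ?_
    simp [block_apply, letterOfFin, branchIncl_basis, op_basis, act_consWord, Letter.state,
      State.activity, State.decomp, act_e, branchProj_basis, neg_eq_of_two (k := k)]

theorem block_op_B : block k (op k .B) = !![op k .A, 0; 0, op k .C] := by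
  apply matrix_eq_of <;>
  · refine (BoundarySpace.basis k).ext fun ξ => ?_
    simp [block_apply, letterOfFin, branchIncl_basis, op_basis, act_consWord, Letter.state,
      State.activity, State.decomp, branchProj_basis]

theorem block_op_C : block k (op k .C) = !![op k .A, 0; 0, op k .D] := by
  apply matrix_eq_of <;>
  · refine (BoundarySpace.basis k).ext fun ξ => ?_
    simp [block_apply, letterOfFin, branchIncl_basis, op_basis, act_consWord, Letter.state,
      State.activity, State.decomp, branchProj_basis]

theorem block_op_D : block k (op k .D) = !![0, 0; 0, op k .B] := by
  apply matrix_eq_of <;>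
  · refine (BoundarySpace.basis k).ext fun ξ => ?_
    simp [block_apply, letterOfFin, branchIncl_basis, op_basis, act_consWord, Letter.state,
      State.activity, State.decomp, act_e, branchProj_basis]

/-- Endomorphisms which vanish on the first branch and permute themselves on the second one are
zero if they vanish on the word `222…`. -/
theorem eq_zero_of_block {ι : Type*} (T : ι → Module.End k (BoundarySpace k)) (f : ι → ι)
    (h : ∀ i, block k (T i) = !![0, 0; 0, T (f i)])
    (h' : ∀ i, T i (BoundarySpace.basis k fun _ => true) = 0) (i : ι) : T i = 0 := by
  have h0 : ∀ i v, T i (branchIncl k false v) = 0 := by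
    intro i v
    have a := LinearMap.congr_fun (congrFun (congrFun (h i) 0) 0) v
    have b := LinearMap.congr_fun (congrFun (congrFun (h i) 1) 0) v
    have e := LinearMap.congr_fun (branchIncl_comp_proj_add (k := k)) (T i (branchIncl k false v))
    simp [block_apply, letterOfFin] at a b e
    rw [← e, a, b]; simp
  have h1 : ∀ i v, T i (branchIncl k true v) = branchIncl k true (T (f i) v) := by
    intro i v
    have a := LinearMap.congr_fun (congrFun (congrFun (h i) 0) 1) v
    have b := LinearMap.congr_fun (congrFun (congrFun (h i) 1) 1) v
    have e := LinearMap.congr_fun (branchIncl_comp_proj_add (k := k)) (T i (branchIncl k true v))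
    simp [block_apply, letterOfFin] at a b e
    rw [← e, a, b]; simp
  refine (BoundarySpace.basis k).ext fun ξ => ?_
  by_cases hξ : ∃ n, ξ n = false
  · obtain ⟨n, hn⟩ := hξ
    -- Each letter 2 passes from `T i` to `T (f i)`; the first letter 1 gives zero. Only the word
    -- 222… never meets a letter 1.
    induction n generalizing i ξ with
    | zero =>
      rw [← consWord_tail ξ, hn, ← branchIncl_basis, h0]; simp
    | succ n ih =>
      rw [← consWord_tail ξ, ← branchIncl_basis]
      cases ξ 0
      · rw [h0]; simp
      · rw [h1, ih (f i) _ hn]; simp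
  · have : ξ = fun _ => true := by
      funext n
      simpa using fun hn => hξ ⟨n, hn⟩
    rw [this, h']; simp

theorem act_true (s : Letter) (hs : s ≠ .A) : s.state.act (fun _ => true) = fun _ => true := by
  funext n
  induction n generalizing s with
  | zero => cases s <;> simp [State.act, State.activity, Letter.state] at hs ⊢
  | succ n ih =>
    cases s
    · exact absurd rfl hs
    · exact ih .C (by simp)
    · exact ih .D (by simp)
    · exact ih .B (by simp)

theorem op_basis_true (s : Letter) (hs : s ≠ .A) :
    op k s (BoundarySpace.basis k fun _ => true) = 0 := by
  rw [op_basis, act_true s hs, sub_self]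

theorem op_A_mul_A [CharP k 2] : op k .A * op k .A = 0 := by
  apply block_injective
  rw [map_mul, block_op_A, map_zero]
  ext i j : 2
  fin_cases i <;> fin_cases j <;> simp [Matrix.mul_apply, add_self_of_two (k := k)]

/-- The matrix is diag(A + A, C + D + B), so in characteristic 2 the sum reproduces itself on the
second branch. -/
theorem op_B_add_C_add_D [CharP k 2] : op k .B + op k .C + op k .D = 0 := by
  refine eq_zero_of_block (fun _ : Unit => op k .B + op k .C + op k .D) id (fun _ => ?_)
    (fun _ => ?_) ()
  · rw [map_add, map_add, block_op_B, block_op_C, block_op_D]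
    ext i j : 2
    fin_cases i <;> fin_cases j <;> simp [add_self_of_two (k := k)]
    abel
  · simp [op_basis_true]

/-- The inverse of the substitution `σ` on the letters `B`, `C`, `D`. -/
def nextLetter : Letter → Letter
  | .A => .A
  | .B => .C
  | .C => .D
  | .D => .B

theorem nextLetter_ne {s : Letter} (hs : s ≠ .A) : nextLetter s ≠ .A := by
  cases s <;> simp_all [nextLetter]

/-- The nine products permute among themselves on the second branch, and on the first branch they
give A² or 0, hence 0. -/
theorem op_mul_op [CharP k 2] {s t : Letter} (hs : s ≠ .A) (ht : t ≠ .A) :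
    op k s * op k t = 0 := by
  have := eq_zero_of_block (k := k)
    (fun i : {s : Letter // s ≠ .A} × {s : Letter // s ≠ .A} => op k i.1.1 * op k i.2.1)
    (fun i => (⟨nextLetter i.1.1, nextLetter_ne i.1.2⟩, ⟨nextLetter i.2.1, nextLetter_ne i.2.2⟩))
    (by
      rintro ⟨⟨s, hs⟩, ⟨t, ht⟩⟩
      refine matrix_eq_of _ ?_ ?_ ?_ ?_ <;> cases s <;> cases t <;> simp at hs ht <;>
        simp [nextLetter, block_op_B, block_op_C, block_op_D, op_A_mul_A])
    (by
      rintro ⟨⟨s, hs⟩, ⟨t, ht⟩⟩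
      simp [op_basis_true t ht]) (⟨s, hs⟩, ⟨t, ht⟩)
  exact this

/-- The matrix is diag(0, B²). -/
theorem op_D_mul_A_mul_D [CharP k 2] : op k .D * op k .A * op k .D = 0 := by
  apply block_injective
  refine Matrix.ext fun i j => ?_
  fin_cases i <;> fin_cases j <;> simp [block_op_A, block_op_D, op_mul_op]

/-! ### Alternating words and the substitution -/

section Alternating
variable {W : Type*} [Ring W] [Algebra k W]

/-- The span of the images of `B`, `C`, `D`. -/
def nonASpan (k : Type*) [Field k] {W : Type*} [Ring W] [Algebra k W] (g : Letter → W) :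
    Submodule k W :=
  Submodule.span k {g .B, g .C, g .D}

/-- The line spanned by the image of a letter. -/
abbrev letterSpan (k : Type*) [Field k] {W : Type*} [Ring W] [Algebra k W] (g : Letter → W)
    (s : Letter) : Submodule k W :=
  Submodule.span k {g s}

/-- The span of the alternating words with `m` letters `A` which neither start nor end with `A`. -/
def altSpan (k : Type*) [Field k] {W : Type*} [Ring W] [Algebra k W] (g : Letter → W) (m : ℕ) :
    Submodule k W :=
  nonASpan k g * (letterSpan k g .A * nonASpan k g) ^ m

theorem mem_nonASpan (g : Letter → W) {s : Letter} (hs : s ≠ .A) : g s ∈ nonASpan k g := by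
  apply Submodule.subset_span
  cases s <;> simp_all

theorem nonASpan_induction {g : Letter → W} {p : W → Prop} (hB : p (g .B)) (hC : p (g .C))
    (hD : p (g .D)) (h0 : p 0) (hadd : ∀ x y, p x → p y → p (x + y))
    (hsmul : ∀ (c : k) x, p x → p (c • x)) {x : W} (hx : x ∈ nonASpan k g) : p x := by
  refine Submodule.span_induction (p := fun x _ => p x) ?_ h0 (fun x y _ _ => hadd x y)
    (fun c x _ => hsmul c x) hx
  rintro x (rfl | rfl | rfl) <;> assumption

variable {g : Letter → W} {φ : W →ₐ[k] Module.End k (BoundarySpace k)} {τ : W →ₐ[k] W}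

theorem mul_eq_zero_of_nonASpan [CharP k 2] (hφ : ∀ s, φ (g s) = op k s) {x : W}
    (hx : x ∈ nonASpan k g) (s : Letter) (hs : s ≠ .A) :
    φ x * op k s = 0 ∧ op k s * φ x = 0 := by
  refine nonASpan_induction (k := k) (p := fun x => φ x * op k s = 0 ∧ op k s * φ x = 0)
    ?_ ?_ ?_ ?_ ?_ ?_ hx
  · simp [hφ, op_mul_op, hs]
  · simp [hφ, op_mul_op, hs]
  · simp [hφ, op_mul_op, hs]
  · simp
  · rintro x y ⟨h1, h2⟩ ⟨h3, h4⟩; simp [add_mul, mul_add, *]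
  · rintro c x ⟨h1, h2⟩; simp [*]

/-- The substitution sends `A` to `ACA`, `B` to `D`, `C` to `B` and `D` to `C`. -/
def IsSubstitution (g : Letter → W) (τ : W →ₐ[k] W) : Prop :=
  τ (g .A) = g .A * g .C * g .A ∧ τ (g .B) = g .D ∧ τ (g .C) = g .B ∧ τ (g .D) = g .C

/-- On B, C, D the substitution undoes the passage to the second branch; the first branch retains
only a multiple of A, which longer words will kill. -/
theorem block_substitution_nonA (hφ : ∀ s, φ (g s) = op k s) (hτ : IsSubstitution g τ) {x : W}
    (hx : x ∈ nonASpan k g) :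
    ∃ p : k, block k (φ (τ x)) = !![p • op k .A, 0; 0, φ x] := by
  refine nonASpan_induction (k := k)
    (p := fun x => ∃ p : k, block k (φ (τ x)) = !![p • op k .A, 0; 0, φ x]) ?_ ?_ ?_ ?_ ?_ ?_ hx
  · exact ⟨0, by simp [hτ.2.1, hφ, block_op_D]⟩
  · exact ⟨1, by simp [hτ.2.2.1, hφ, block_op_B]⟩
  · exact ⟨1, by simp [hτ.2.2.2, hφ, block_op_C]⟩
  · refine ⟨0, matrix_eq_of _ ?_ ?_ ?_ ?_⟩ <;> simp
  · rintro x y ⟨p, hp⟩ ⟨q, hq⟩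
    exact ⟨p + q, by simp [hp, hq, add_smul]⟩
  · rintro c x ⟨p, hp⟩
    exact ⟨c * p, by simp [hp, mul_smul]⟩

theorem block_substitution_A [CharP k 2] (hφ : ∀ s, φ (g s) = op k s) (hτ : IsSubstitution g τ) :
    block k (φ (τ (g .A))) = !![op k .A + op k .D, op k .A + op k .D;
      op k .A + op k .D, op k .A + op k .D] := by
  simp [hτ.1, hφ, block_op_A, block_op_C]

/-- The elements, such as words `A…A`, on which the substitution acts as multiplication of the
matrix with all entries `1`. -/
def midSubmodule (φ : W →ₐ[k] Module.End k (BoundarySpace k)) (τ : W →ₐ[k] W) :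
    Submodule k W where
  carrier := {y | block k (φ (τ y)) = !![φ y, φ y; φ y, φ y] ∧ op k .A * φ y = 0 ∧
    φ y * op k .A = 0}
  zero_mem' := ⟨matrix_eq_of _ (by simp) (by simp) (by simp) (by simp), by simp, by simp⟩
  add_mem' := by
    rintro x y ⟨h1, h2, h3⟩ ⟨h4, h5, h6⟩
    exact ⟨by simp [h1, h4], by simp [mul_add, *], by simp [add_mul, *]⟩
  smul_mem' := by
    rintro c x ⟨h1, h2, h3⟩
    exact ⟨by simp [h1], by simp [*], by simp [*]⟩

/-- Every entry of the matrix of σ(A) is A + D. The excess D is absorbed on both sides of x, since D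
x = x D = 0, and the contribution pA of the first branch dies by A² = 0 and DAD = 0. -/
theorem mem_midSubmodule_of_A [CharP k 2] (hφ : ∀ s, φ (g s) = op k s) (hτ : IsSubstitution g τ)
    {x : W} (hx : x ∈ nonASpan k g) : g .A * x * g .A ∈ midSubmodule φ τ := by
  obtain ⟨p, hp⟩ := block_substitution_nonA hφ hτ hx
  obtain ⟨h1, h2⟩ := mul_eq_zero_of_nonASpan hφ hx .D (by simp)
  have hA := op_A_mul_A (k := k)
  have hD := op_D_mul_A_mul_D (k := k)
  have hA' : ∀ z, op k .A * (op k .A * z) = 0 := fun z => by rw [← mul_assoc, hA, zero_mul]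
  have h2' : ∀ z, op k .D * (φ x * z) = 0 := fun z => by rw [← mul_assoc, h2, zero_mul]
  rw [mul_assoc] at hD
  refine ⟨?_, ?_, ?_⟩
  · simp only [map_mul, hp, block_substitution_A hφ hτ, hφ, Matrix.mul_fin_two]
    refine matrix_eq_of _ ?_ ?_ ?_ ?_ <;>
      simp [mul_add, add_mul, mul_assoc, hA, hD, h1, h2']
  · simp [hφ, mul_assoc, hA']
  · simp [hφ, mul_assoc, hA]

theorem mem_midSubmodule_mul [CharP k 2] (hφ : ∀ s, φ (g s) = op k s) (hτ : IsSubstitution g τ)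
    {x y : W} (hy : y ∈ midSubmodule φ τ) (hx : x ∈ nonASpan k g) :
    y * x * g .A ∈ midSubmodule φ τ := by
  obtain ⟨p, hp⟩ := block_substitution_nonA hφ hτ hx
  obtain ⟨h1, h2⟩ := mul_eq_zero_of_nonASpan hφ hx .D (by simp)
  obtain ⟨h3, h4, h5⟩ := hy
  have hA := op_A_mul_A (k := k)
  have h4' : ∀ z, op k .A * (φ y * z) = 0 := fun z => by rw [← mul_assoc, h4, zero_mul]
  have h5' : ∀ z, φ y * (op k .A * z) = 0 := fun z => by rw [← mul_assoc, h5, zero_mul]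
  refine ⟨?_, ?_, ?_⟩
  · simp only [map_mul, hp, h3, block_substitution_A hφ hτ, hφ, Matrix.mul_fin_two]
    refine matrix_eq_of _ ?_ ?_ ?_ ?_ <;>
      simp [mul_add, mul_assoc, h5, h1]
  · simp [hφ, mul_assoc, h4']
  · simp [hφ, mul_assoc, hA]

/-- The elements with image zero on the first branch under the substitution. -/
def liftSubmodule (φ : W →ₐ[k] Module.End k (BoundarySpace k)) (τ : W →ₐ[k] W) :
    Submodule k W where
  carrier := {y | block k (φ (τ y)) = !![0, 0; 0, φ y]}
  zero_mem' := matrix_eq_of _ (by simp) (by simp) (by simp) (by simp)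
  add_mem' := by
    rintro x y (h1 : block k _ = _) (h2 : block k _ = _)
    simp [h1, h2]
  smul_mem' := by
    rintro c x (h1 : block k _ = _)
    simp [h1]

/-- Outside the lower right corner, every entry has a factor A adjacent to y, and y is annihilated
by A on both sides. -/
theorem mem_liftSubmodule_of_mid (hφ : ∀ s, φ (g s) = op k s)
    (hτ : IsSubstitution g τ) {x y z : W} (hx : x ∈ nonASpan k g) (hy : y ∈ midSubmodule φ τ)
    (hz : z ∈ nonASpan k g) : x * y * z ∈ liftSubmodule φ τ := by
  obtain ⟨p, hp⟩ := block_substitution_nonA hφ hτ hx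
  obtain ⟨q, hq⟩ := block_substitution_nonA hφ hτ hz
  obtain ⟨h3, h4, h5⟩ := hy
  have h4' : ∀ z, op k .A * (φ y * z) = 0 := fun z => by rw [← mul_assoc, h4, zero_mul]
  change block k _ = _
  simp only [map_mul, hp, h3, hq, Matrix.mul_fin_two]
  refine matrix_eq_of _ ?_ ?_ ?_ ?_ <;> simp [mul_assoc, h4, h5]

theorem altMiddle_le [CharP k 2] (hφ : ∀ s, φ (g s) = op k s) (hτ : IsSubstitution g τ) (m : ℕ) :
    (letterSpan k g .A * nonASpan k g) ^ (m + 1) * letterSpan k g .A ≤ midSubmodule φ τ := by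
  have hs : ∀ z ∈ letterSpan k g .A, ∃ c : k, z = c • g .A := fun z hz => by
    obtain ⟨c, rfl⟩ := Submodule.mem_span_singleton.1 hz; exact ⟨c, rfl⟩
  induction m with
  | zero =>
    rw [zero_add, pow_one, mul_assoc, Submodule.mul_le]
    intro a ha y hy
    obtain ⟨c, rfl⟩ := hs a ha
    rw [smul_mul_assoc]
    refine Submodule.smul_mem _ _ ?_
    induction hy using Submodule.mul_induction_on' with
    | mem_mul_mem x hx z hz =>
      obtain ⟨d, rfl⟩ := hs z hz
      rw [mul_smul_comm, mul_smul_comm, ← mul_assoc]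
      exact Submodule.smul_mem _ _ (mem_midSubmodule_of_A hφ hτ hx)
    | add x _ y _ h1 h2 => rw [mul_add]; exact add_mem h1 h2
  | succ m ih =>
    rw [pow_succ, ← mul_assoc, mul_assoc, Submodule.mul_le]
    intro y hy w hw
    have hy' := ih hy
    induction hw using Submodule.mul_induction_on' with
    | mem_mul_mem x hx z hz =>
      obtain ⟨d, rfl⟩ := hs z hz
      rw [mul_smul_comm, mul_smul_comm, ← mul_assoc]
      exact Submodule.smul_mem _ _ (mem_midSubmodule_mul hφ hτ hy' hx)
    | add x _ y _ h1 h2 => rw [mul_add]; exact add_mem h1 h2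

/-- Two letters A are needed so that the middle part A…A contains a letter other than A: for the
middle part A alone, the entries of σ(A) are A + D and not A. -/
theorem altSpan_le_liftSubmodule [CharP k 2] (hφ : ∀ s, φ (g s) = op k s)
    (hτ : IsSubstitution g τ) (m : ℕ) : altSpan k g (m + 2) ≤ liftSubmodule φ τ := by
  rw [altSpan, pow_succ, ← mul_assoc, ← mul_assoc, mul_assoc (nonASpan k g), Submodule.mul_le]
  intro y hy z hz
  induction hy using Submodule.mul_induction_on' with
  | mem_mul_mem x hx y hy => exact mem_liftSubmodule_of_mid hφ hτ hx (altMiddle_le hφ hτ m hy) hz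
  | add x _ y _ h1 h2 => rw [add_mul]; exact add_mem h1 h2

theorem map_nonASpan (hτ : IsSubstitution g τ) :
    (nonASpan k g).map τ.toLinearMap = nonASpan k g := by
  rw [nonASpan, Submodule.map_span]
  congr 1
  ext x
  simp [Set.image_insert_eq, hτ.2.1, hτ.2.2.1, hτ.2.2.2]
  tauto

theorem map_altSpan (hτ : IsSubstitution g τ) (m : ℕ) :
    (altSpan k g m).map τ.toLinearMap =
      nonASpan k g * (letterSpan k g .A * letterSpan k g .C * letterSpan k g .A * nonASpan k g) ^ m := by
  have h : (letterSpan k g .A).map τ.toLinearMap = letterSpan k g .A * letterSpan k g .C * letterSpan k g .A := by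
    rw [Submodule.map_span, Set.image_singleton, AlgHom.toLinearMap_apply, hτ.1,
      Submodule.span_mul_span, Submodule.span_mul_span, Set.singleton_mul_singleton,
      Set.singleton_mul_singleton]
  rw [altSpan, Submodule.map_mul, Submodule.map_pow, Submodule.map_mul, map_nonASpan hτ, h]

/-- Makes the lifting property iterable: the image under σ is again alternating, with twice as many
letters A. -/
theorem map_altSpan_le (hτ : IsSubstitution g τ) (m : ℕ) :
    (altSpan k g m).map τ.toLinearMap ≤ altSpan k g (2 * m) := by
  rw [map_altSpan hτ, altSpan, pow_mul, pow_two]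
  have h : letterSpan k g .C ≤ nonASpan k g := by
    simpa [Submodule.span_singleton_le_iff_mem] using mem_nonASpan g (by simp)
  have h' : letterSpan k g .A * letterSpan k g .C * letterSpan k g .A * nonASpan k g ≤
      (letterSpan k g .A * nonASpan k g) * (letterSpan k g .A * nonASpan k g) := by
    rw [mul_assoc]
    gcongr
  gcongr

end Alternating

/-! ### The relations in the tree enveloping algebra -/

variable (k) in
/-- The substitution `σ` on the free algebra. -/
def freeSigma : FreeAlgebra k Letter →ₐ[k] FreeAlgebra k Letter :=
  FreeAlgebra.lift k fun s => monomial k (sigmaLetter s)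

variable (k) in
/-- The action of the free algebra on `k X^ω`. -/
def freeOp : FreeAlgebra k Letter →ₐ[k] Module.End k (BoundarySpace k) :=
  FreeAlgebra.lift k (op k)

theorem freeOp_ι (s : Letter) : freeOp k (FreeAlgebra.ι k s) = op k s := by simp [freeOp]

theorem isSubstitution_freeSigma : IsSubstitution (FreeAlgebra.ι k) (freeSigma k) := by
  simp [IsSubstitution, freeSigma, monomial, sigmaLetter, mul_assoc]

theorem map_monomial {R : Type*} [Ring R] [Algebra k R] (f : FreeAlgebra k Letter →ₐ[k] R)
    (w : List Letter) : f (monomial k w) = (w.map fun s => f (FreeAlgebra.ι k s)).prod := by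
  rw [monomial, map_list_prod, List.map_map]; rfl

theorem freeSigma_monomial (w : List Letter) :
    freeSigma k (monomial k w) = monomial k (sigma w) := by
  rw [map_monomial]
  simp only [freeSigma, FreeAlgebra.lift_ι_apply]
  induction w with
  | nil => simp [sigma, monomial]
  | cons s w ih =>
    rw [List.map_cons, List.prod_cons, ih]
    simp [sigma, monomial]

theorem freeSigma_iterate_monomial (n : ℕ) (w : List Letter) :
    (freeSigma k)^[n] (monomial k w) = monomial k (sigma^[n] w) := by
  induction n generalizing w with
  | zero => rfl
  | succ n ih => rw [Function.iterate_succ_apply, freeSigma_monomial, ih]; rfl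

theorem freeOp_freeSigma_iterate [CharP k 2] (m : ℕ) {x : FreeAlgebra k Letter}
    (hx : x ∈ altSpan k (FreeAlgebra.ι k) (m + 2)) (h : freeOp k x = 0) (n : ℕ) :
    freeOp k ((freeSigma k)^[n] x) = 0 := by
  induction n generalizing x m with
  | zero => exact h
  | succ n ih =>
    rw [Function.iterate_succ_apply]
    refine ih (2 * m + 2) ?_ ?_
    · exact map_altSpan_le (k := k) isSubstitution_freeSigma (m + 2) ⟨x, hx, rfl⟩
    · have : block k (freeOp k (freeSigma k x)) = !![0, 0; 0, freeOp k x] :=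
        altSpan_le_liftSubmodule freeOp_ι isSubstitution_freeSigma m hx
      apply block_injective
      rw [this, h, map_zero]
      exact (matrix_eq_of (k := k) 0 rfl rfl rfl rfl).symm

open Letter in
theorem freeOp_of_mem_relators [CharP k 2] {x : FreeAlgebra k Letter} (hx : x ∈ relators k) :
    freeOp k x = 0 := by
  have hA := op_A_mul_A (k := k)
  have hD := op_D_mul_A_mul_D (k := k)
  rw [mul_assoc] at hD
  rcases hx with hx | ⟨w, ⟨n, hw⟩, rfl⟩
  · rcases hx with rfl | rfl | rfl | rfl | rfl | rfl | rfl | rfl | rfl | rfl | rfl | rfl <;>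
      simp [map_monomial, freeOp_ι, hA, op_mul_op, op_B_add_C_add_D, hD]
  · have hmem : ∀ p q r s : Letter, p ≠ A → q ≠ A → r ≠ A → s ≠ A →
        monomial k [p, A, q, A, r, A, s] ∈ altSpan k (FreeAlgebra.ι k) (1 + 2) := by
      intro p q r s hp hq hr hs
      have e : monomial k [p, A, q, A, r, A, s] = FreeAlgebra.ι k p *
        (FreeAlgebra.ι k A * FreeAlgebra.ι k q * (FreeAlgebra.ι k A * FreeAlgebra.ι k r) *
          (FreeAlgebra.ι k A * FreeAlgebra.ι k s)) := by simp [monomial, mul_assoc]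
      rw [e, altSpan, pow_succ, pow_succ, pow_one]
      have h1 : ∀ t : Letter, t ≠ A → FreeAlgebra.ι k A * FreeAlgebra.ι k t ∈
          letterSpan k (FreeAlgebra.ι k) A * nonASpan k (FreeAlgebra.ι k) := fun t ht =>
        Submodule.mul_mem_mul (Submodule.mem_span_singleton_self _) (mem_nonASpan _ ht)
      exact Submodule.mul_mem_mul (mem_nonASpan _ hp) (Submodule.mul_mem_mul
        (Submodule.mul_mem_mul (h1 _ hq) (h1 _ hr)) (h1 _ hs))
    have hp : ∀ {s t : Letter} (z), s ≠ A → t ≠ A → op k s * (op k t * z) = 0 := fun z hs ht => by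
      rw [← mul_assoc, op_mul_op hs ht, zero_mul]
    have hA' : ∀ z, op k .A * (op k .A * z) = 0 := fun z => by rw [← mul_assoc, hA, zero_mul]
    have hD' : ∀ z, op k .D * (op k .A * (op k .D * z)) = 0 := fun z => by
      rw [← mul_assoc, ← mul_assoc, mul_assoc (op k D), hD, zero_mul]
    rcases hw with rfl | rfl <;> rw [← freeSigma_iterate_monomial]
    -- Three letters A correspond to m = 1. What remains is n = 0, a matrix computation.
    · refine freeOp_freeSigma_iterate 1 (hmem _ _ _ _ (by simp) (by simp) (by simp) (by simp)) ?_ n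
      apply block_injective
      simp only [map_monomial, freeOp_ι, List.map_cons, List.map_nil, List.prod_cons,
        List.prod_nil, mul_one, map_mul, block_op_A, block_op_C, Matrix.mul_fin_two, map_zero]
      refine Matrix.ext fun i j => ?_
      fin_cases i <;> fin_cases j <;>
        simp [hA, hA', hD, hD', op_mul_op, hp]
    · refine freeOp_freeSigma_iterate 1 (hmem _ _ _ _ (by simp) (by simp) (by simp) (by simp)) ?_ n
      apply block_injective
      simp only [map_monomial, freeOp_ι, List.map_cons, List.map_nil, List.prod_cons,
        List.prod_nil, mul_one, map_mul, block_op_A, block_op_C, block_op_D, Matrix.mul_fin_two,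
        map_zero]
      refine Matrix.ext fun i j => ?_
      fin_cases i <;> fin_cases j <;>
        simp [hA', op_mul_op, hp]

/-! ### Algebras given by presentations -/

section Presented
variable {W : Type*} [Ring W] [Algebra k W] {R : Set (FreeAlgebra k Letter)}

variable (k R) in
/-- The quotient map from the free algebra to a presented algebra. -/
def Presented.mk : FreeAlgebra k Letter →ₐ[k] Presented k R :=
  RingQuot.mkAlgHom k fun x y : FreeAlgebra k Letter => x ∈ R ∧ y = 0

theorem Presented.mk_ι (s : Letter) : Presented.mk k R (FreeAlgebra.ι k s) = Presented.gen k R s :=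
  rfl

theorem Presented.mk_surjective : Function.Surjective (Presented.mk k R) :=
  RingQuot.mkAlgHom_surjective k _

theorem Presented.mk_of_mem {x : FreeAlgebra k Letter} (hx : x ∈ R) : Presented.mk k R x = 0 := by
  have := RingQuot.mkAlgHom_rel k (s := fun x y : FreeAlgebra k Letter => x ∈ R ∧ y = 0)
    (x := x) (y := 0) ⟨hx, rfl⟩
  rw [map_zero] at this
  exact this

theorem Presented.mk_monomial (w : List Letter) :
    Presented.mk k R (monomial k w) = (w.map (Presented.gen k R)).prod :=
  map_monomial _ _

/-- The homomorphism from a presented algebra induced by a homomorphism killing the relators. -/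
def Presented.lift {W : Type*} [Semiring W] [Algebra k W] (f : FreeAlgebra k Letter →ₐ[k] W) (hf : ∀ x ∈ R, f x = 0) :
    Presented k R →ₐ[k] W :=
  RingQuot.liftAlgHom k ⟨f, by rintro x y ⟨hx, rfl⟩; rw [hf x hx, map_zero]⟩

theorem Presented.lift_mk {W : Type*} [Semiring W] [Algebra k W] (f : FreeAlgebra k Letter →ₐ[k] W) (hf : ∀ x ∈ R, f x = 0)
    (x : FreeAlgebra k Letter) : Presented.lift f hf (Presented.mk k R x) = f x :=
  RingQuot.liftAlgHom_mkAlgHom_apply _ _ _ _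

variable (k) in
/-- The span of the words of length `n` on the elements `g s`. -/
def wordSpan (g : Letter → W) (n : ℕ) : Submodule k W :=
  Submodule.span k {x | ∃ w : List Letter, w.length = n ∧ x = (w.map g).prod}

open Polynomial in
/-- A homomorphism to polynomials which records the length of words. -/
def IsDegreeHom (g : Letter → W) (Δ : W →ₐ[k] W[X]) : Prop :=
  ∀ s, Δ (g s) = C (g s) * X

open Polynomial in
theorem IsDegreeHom.apply_word {g : Letter → W} {Δ : W →ₐ[k] W[X]} (h : IsDegreeHom g Δ)
    (w : List Letter) : Δ (w.map g).prod = C (w.map g).prod * X ^ w.length := by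
  induction w with
  | nil => simp
  | cons s w ih =>
    rw [List.map_cons, List.prod_cons, map_mul, ih, h s, List.length_cons, pow_succ', C_mul,
      mul_assoc, mul_assoc, ← mul_assoc X, X_mul_C, mul_assoc]

open Polynomial in
theorem IsDegreeHom.apply_of_mem {g : Letter → W} {Δ : W →ₐ[k] W[X]} (h : IsDegreeHom g Δ)
    {n : ℕ} {x : W} (hx : x ∈ wordSpan k g n) : Δ x = C x * X ^ n := by
  induction hx using Submodule.span_induction with
  | mem x hx =>
    obtain ⟨w, rfl, rfl⟩ := hx
    exact h.apply_word w
  | zero => simp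
  | add x y _ _ hx hy => rw [map_add, hx, hy, C_add, add_mul]
  | smul c x _ hx => rw [map_smul, hx, ← smul_mul_assoc, smul_C]

-- Homogeneous relators are respected by s ↦ s X, so the exponent of X records word length on the
-- quotient.
open Polynomial in
theorem Presented.exists_isDegreeHom
    (hR : ∀ x ∈ R, ∃ n, x ∈ wordSpan k (FreeAlgebra.ι k) n) :
    ∃ Δ : Presented k R →ₐ[k] (Presented k R)[X], IsDegreeHom (Presented.gen k R) Δ := by
  let f : FreeAlgebra k Letter →ₐ[k] (Presented k R)[X] :=
    FreeAlgebra.lift k fun s => C (Presented.gen k R s) * X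
  have hf : ∀ (n : ℕ) (x : FreeAlgebra k Letter), x ∈ wordSpan k (FreeAlgebra.ι k) n →
      f x = C (Presented.mk k R x) * X ^ n := by
    intro n x hx
    induction hx using Submodule.span_induction with
    | mem x hx =>
      obtain ⟨w, rfl, rfl⟩ := hx
      induction w with
      | nil => simp
      | cons s w ih =>
        rw [List.map_cons, List.prod_cons, map_mul, ih, List.length_cons, pow_succ', map_mul, C_mul,
          FreeAlgebra.lift_ι_apply, Presented.mk_ι, mul_assoc, mul_assoc, ← mul_assoc X, X_mul_C,
          mul_assoc]
    | zero => simp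
    | add x y _ _ hx hy => rw [map_add, hx, hy, map_add, C_add, add_mul]
    | smul c x _ hx => rw [map_smul, hx, map_smul, ← smul_mul_assoc, smul_C]
  refine ⟨Presented.lift f fun x hx => ?_, fun s => ?_⟩
  · obtain ⟨n, hn⟩ := hR x hx
    rw [hf n x hn, Presented.mk_of_mem hx, C_0, zero_mul]
  · rw [← Presented.mk_ι, Presented.lift_mk, FreeAlgebra.lift_ι_apply, Presented.mk_ι]

theorem monomial_mem_wordSpan (w : List Letter) :
    monomial k w ∈ wordSpan k (FreeAlgebra.ι k) w.length :=
  Submodule.subset_span ⟨w, rfl, rfl⟩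

theorem exists_wordSpan_of_mem_relators {x : FreeAlgebra k Letter} (hx : x ∈ relators k) :
    ∃ n, x ∈ wordSpan k (FreeAlgebra.ι k) n := by
  rcases hx with hx | ⟨w, -, rfl⟩
  · rcases hx with rfl | rfl | rfl | rfl | rfl | rfl | rfl | rfl | rfl | rfl | rfl | rfl
    case inr.inr.inr.inr.inl =>
      exact ⟨1, add_mem (add_mem (monomial_mem_wordSpan [.B]) (monomial_mem_wordSpan [.C]))
        (monomial_mem_wordSpan [.D])⟩
    all_goals exact ⟨_, monomial_mem_wordSpan _⟩
  · exact ⟨_, monomial_mem_wordSpan _⟩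

end Presented

/-! ### A cover of the presented algebra on which the substitution is defined -/

open Letter in
variable (k) in
/-- The relators obtained by replacing `DAD` by its products with the words `Ax` and `xA` for `x`
in `{B, C, D}`. -/
def coverRelators : Set (FreeAlgebra k Letter) :=
  {x | (∃ s t : Letter, s ≠ A ∧ t ≠ A ∧ x = monomial k [s, t]) ∨
    x = monomial k [A, A] ∨ x = monomial k [B] + monomial k [C] + monomial k [D] ∨
    (∃ s : Letter, s ≠ A ∧ (x = monomial k [D, A, D, A, s] ∨ x = monomial k [s, A, D, A, D]))} ∪
  monomial k '' sigmaRelators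

variable (k) in
/-- The algebra with the relators `coverRelators`. -/
abbrev Cover : Type _ := Presented k (coverRelators k)

variable (k) in
/-- The generators of `Cover`. -/
abbrev cg (s : Letter) : Cover k := Presented.gen k (coverRelators k) s

theorem exists_wordSpan_of_mem_coverRelators {x : FreeAlgebra k Letter}
    (hx : x ∈ coverRelators k) : ∃ n, x ∈ wordSpan k (FreeAlgebra.ι k) n := by
  rcases hx with (⟨s, t, -, -, rfl⟩ | rfl | rfl | ⟨s, -, rfl | rfl⟩) | ⟨w, -, rfl⟩
  case inl.inr.inr.inl =>
    exact ⟨1, add_mem (add_mem (monomial_mem_wordSpan [.B]) (monomial_mem_wordSpan [.C]))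
      (monomial_mem_wordSpan [.D])⟩
  all_goals exact ⟨_, monomial_mem_wordSpan _⟩

theorem cg_mul_cg {s t : Letter} (hs : s ≠ .A) (ht : t ≠ .A) : cg k s * cg k t = 0 := by
  have := Presented.mk_of_mem (R := coverRelators k) (x := monomial k [s, t])
    (.inl (.inl ⟨s, t, hs, ht, rfl⟩))
  simpa [Presented.mk_monomial] using this

theorem cg_A_mul_A : cg k .A * cg k .A = 0 := by
  have := Presented.mk_of_mem (R := coverRelators k) (x := monomial k [.A, .A])
    (.inl (.inr (.inl rfl)))
  simpa [Presented.mk_monomial] using this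

theorem cg_add : cg k .B + cg k .C + cg k .D = 0 := by
  have := Presented.mk_of_mem (R := coverRelators k)
    (x := monomial k [.B] + monomial k [.C] + monomial k [.D]) (.inl (.inr (.inr (.inl rfl))))
  simpa [Presented.mk_monomial] using this

theorem cg_DADA {s : Letter} (hs : s ≠ .A) :
    cg k .D * (cg k .A * (cg k .D * (cg k .A * cg k s))) = 0 := by
  have := Presented.mk_of_mem (R := coverRelators k) (x := monomial k [.D, .A, .D, .A, s])
    (.inl (.inr (.inr (.inr ⟨s, hs, .inl rfl⟩))))
  simpa [Presented.mk_monomial] using this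

theorem cg_ADAD {s : Letter} (hs : s ≠ .A) :
    cg k s * (cg k .A * (cg k .D * (cg k .A * cg k .D))) = 0 := by
  have := Presented.mk_of_mem (R := coverRelators k) (x := monomial k [s, .A, .D, .A, .D])
    (.inl (.inr (.inr (.inr ⟨s, hs, .inr rfl⟩))))
  simpa [Presented.mk_monomial] using this

theorem cg_sigma {w : List Letter} (hw : w ∈ sigmaRelators) : (w.map (cg k)).prod = 0 := by
  have := Presented.mk_of_mem (R := coverRelators k) (x := monomial k w) (.inr ⟨w, hw, rfl⟩)
  simpa [Presented.mk_monomial] using this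

theorem cg_CACACAC : cg k .C * (cg k .A * (cg k .C * (cg k .A * (cg k .C * (cg k .A * cg k .C)))))
    = 0 := by
  simpa using cg_sigma (k := k) ⟨0, .inl rfl⟩

theorem cg_DACACAD : cg k .D * (cg k .A * (cg k .C * (cg k .A * (cg k .C * (cg k .A * cg k .D)))))
    = 0 := by
  simpa using cg_sigma (k := k) ⟨0, .inr rfl⟩

theorem sigmaLetter_ne {s : Letter} (hs : s ≠ .A) : ∃ t : Letter, t ≠ .A ∧ sigmaLetter s = [t] := by
  cases s <;> simp_all [sigmaLetter]

-- This is where the weakening of DAD is needed: σ(DADAx) = CACACAC·A·σ(x), and symmetrically for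
-- xADAD, while σ(DAD) itself is not a consequence of the relators.
open Letter in
theorem mk_freeSigma_of_mem {x : FreeAlgebra k Letter} (hx : x ∈ coverRelators k) :
    Presented.mk k (coverRelators k) (freeSigma k x) = 0 := by
  rcases hx with (⟨s, t, hs, ht, rfl⟩ | rfl | rfl | ⟨s, hs, rfl | rfl⟩) | ⟨_, ⟨n, hw⟩, rfl⟩
  · obtain ⟨s', hs', es⟩ := sigmaLetter_ne hs
    obtain ⟨t', ht', et⟩ := sigmaLetter_ne ht
    rw [freeSigma_monomial, Presented.mk_monomial]
    simpa only [sigma, List.flatMap_cons, List.flatMap_nil, es, et, List.cons_append,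
      List.nil_append, List.map_cons, List.map_nil, List.prod_cons, List.prod_nil, mul_one]
      using cg_mul_cg hs' ht'
  · have h := congrArg (fun z => cg k A * cg k C * z * (cg k C * cg k A)) (cg_A_mul_A (k := k))
    rw [freeSigma_monomial, Presented.mk_monomial]
    simpa only [sigma, sigmaLetter, List.flatMap_cons, List.flatMap_nil, List.cons_append,
      List.nil_append, List.map_cons, List.map_nil, List.prod_cons, List.prod_nil, mul_one,
      mul_assoc, mul_zero, zero_mul] using h
  · simp only [map_add, freeSigma_monomial, Presented.mk_monomial]
    simp only [sigma, sigmaLetter, List.flatMap_cons, List.flatMap_nil, List.append_nil,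
      List.map_cons, List.map_nil, List.prod_cons, List.prod_nil, mul_one]
    rw [← cg_add (k := k)]
    abel
  · obtain ⟨s', hs', es⟩ := sigmaLetter_ne hs
    have h := congrArg (· * (cg k A * cg k s')) (cg_CACACAC (k := k))
    rw [freeSigma_monomial, Presented.mk_monomial]
    simp only [sigma, List.flatMap_cons, es]
    simpa only [sigmaLetter, List.flatMap_nil, List.cons_append,
      List.nil_append, List.map_cons, List.map_nil, List.prod_cons, List.prod_nil, mul_one,
      mul_assoc, mul_zero, zero_mul] using h
  · obtain ⟨s', hs', es⟩ := sigmaLetter_ne hs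
    have h := congrArg ((cg k s' * cg k A) * ·) (cg_CACACAC (k := k))
    rw [freeSigma_monomial, Presented.mk_monomial]
    simp only [sigma, List.flatMap_cons, es]
    simpa only [sigmaLetter, List.flatMap_nil, List.cons_append,
      List.nil_append, List.map_cons, List.map_nil, List.prod_cons, List.prod_nil, mul_one,
      mul_assoc, mul_zero, zero_mul] using h
  · refine Presented.mk_of_mem (.inr ⟨_, ⟨n + 1, ?_⟩, (freeSigma_monomial _).symm⟩)
    rw [Function.iterate_succ_apply', Function.iterate_succ_apply']
    rcases hw with rfl | rfl <;> simp

variable (k) in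
/-- The substitution on `Cover`. -/
def coverSigma : Cover k →ₐ[k] Cover k :=
  Presented.lift ((Presented.mk k (coverRelators k)).comp (freeSigma k))
    fun _ hx => mk_freeSigma_of_mem hx

theorem isSubstitution_coverSigma : IsSubstitution (cg k) (coverSigma k) := by
  simp [IsSubstitution, cg, ← Presented.mk_ι, coverSigma, Presented.lift_mk, freeSigma, monomial,
    sigmaLetter, mul_assoc]

variable (k) in
/-- The action of the presented algebra on `k X^ω`. -/
def presentedOp [CharP k 2] : Presented k (relators k) →ₐ[k] Module.End k (BoundarySpace k) :=
  Presented.lift (freeOp k) fun _ hx => freeOp_of_mem_relators hx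

theorem presentedOp_gen [CharP k 2] (s : Letter) :
    presentedOp k (Presented.gen k (relators k) s) = op k s := by
  rw [← Presented.mk_ι, presentedOp, Presented.lift_mk, freeOp_ι]

open Letter in
theorem mk_of_mem_coverRelators {x : FreeAlgebra k Letter} (hx : x ∈ coverRelators k) :
    Presented.mk k (relators k) x = 0 := by
  have hD : monomial k [D, A, D] ∈ relators k := .inl (by simp [relators₀])
  have e := Presented.mk_of_mem hD
  rcases hx with (⟨s, t, hs, ht, rfl⟩ | rfl | rfl | ⟨s, hs, rfl | rfl⟩) | h
  · refine Presented.mk_of_mem (.inl ?_)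
    cases s <;> cases t <;> simp_all [relators₀]
  · exact Presented.mk_of_mem (.inl (by simp [relators₀]))
  · exact Presented.mk_of_mem (.inl (by simp [relators₀]))
  · have h : monomial k [D, A, D, A, s] = monomial k [D, A, D] * monomial k [A, s] := by
      simp [monomial, mul_assoc]
    rw [h, map_mul, e, zero_mul]
  · have h : monomial k [s, A, D, A, D] = monomial k [s, A] * monomial k [D, A, D] := by
      simp [monomial, mul_assoc]
    rw [h, map_mul, e, mul_zero]
  · exact Presented.mk_of_mem (.inr h)

variable (k) in
/-- The projection from `Cover` to the presented algebra. -/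
def coverProj : Cover k →ₐ[k] Presented k (relators k) :=
  Presented.lift (Presented.mk k (relators k)) fun _ hx => mk_of_mem_coverRelators hx

theorem coverProj_cg (s : Letter) : coverProj k (cg k s) = Presented.gen k (relators k) s := by
  rw [cg, ← Presented.mk_ι, coverProj, Presented.lift_mk, Presented.mk_ι]

theorem coverProj_surjective : Function.Surjective (coverProj k) := by
  intro x
  obtain ⟨y, rfl⟩ := Presented.mk_surjective x
  exact ⟨Presented.mk k _ y, Presented.lift_mk _ _ _⟩

variable (k) in
/-- The action of `Cover` on `k X^ω`. -/
def coverOp [CharP k 2] : Cover k →ₐ[k] Module.End k (BoundarySpace k) :=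
  (presentedOp k).comp (coverProj k)

theorem coverOp_cg [CharP k 2] (s : Letter) : coverOp k (cg k s) = op k s := by
  rw [coverOp, AlgHom.comp_apply, coverProj_cg, presentedOp_gen]

/-! ### Alternating words are images of the substitution -/

section Semiring
variable {S : Type*} [IdemSemiring S] {a c d : S}

/-- The letter before the final d must be c by `hcd`, and then the first letter must be c by `h4`.
-/
theorem alt_mul_a_mul_d_le (hcd : c * (a * (d * (a * d))) = 0)
    (h4 : d * (a * (c * (a * (c * (a * d))))) = 0) :
    (c + d) * (a * c * a * (c + d)) * (a * d) ≤ c * (a * (c * (a * (c * (a * d))))) := by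
  simp only [mul_add, add_mul, mul_assoc, hcd, h4, mul_zero, add_zero]
  rfl

/-- As before, a final d forces c's in front of it; in a word of this length they add up to the
factor c a c a c a c. -/
theorem alt_mul_a_mul_d_eq_zero (hcd : c * (a * (d * (a * d))) = 0)
    (h3 : c * (a * (c * (a * (c * (a * c))))) = 0)
    (h4 : d * (a * (c * (a * (c * (a * d))))) = 0) (j : ℕ) :
    (c + d) * (a * c * a * (c + d)) ^ (j + 2) * (a * d) = 0 := by
  have h3' : ∀ z, c * (a * (c * (a * (c * (a * (c * z)))))) = 0 := fun z => by
    simpa [mul_assoc] using congrArg (· * z) h3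
  rw [pow_succ, pow_succ]
  simp only [mul_add, add_mul, mul_assoc, hcd, h4, h3', mul_zero, add_zero]

/-- The idempotent semiring is that of submodules, with a, c, d the lines spanned by A, C, D; signs
and coefficients disappear. All letters d have positions of one parity, so every second letter
outside a is c. The two summands of each bound are the two parities. The proof appends one letter at
a time; a d of the wrong parity is possible only after a short run of c's. -/
theorem alt_le (hdc : d * (a * (d * (a * c))) = 0)
    (hcd : c * (a * (d * (a * d))) = 0) (hdd : d * (a * (d * (a * d))) = 0)
    (h3 : c * (a * (c * (a * (c * (a * c))))) = 0)
    (h4 : d * (a * (c * (a * (c * (a * d))))) = 0) (j : ℕ) :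
    (c + d) * (a * (c + d)) ^ (2 * j + 2) ≤ (c + d) * (a * c * a * (c + d)) ^ (j + 1) +
        c * a * ((c + d) * (a * c * a * (c + d)) ^ j) * (a * c) ∧
      (c + d) * (a * (c + d)) ^ (2 * j + 3) ≤
        (c + d) * (a * c * a * (c + d)) ^ (j + 1) * (a * c) +
        c * a * ((c + d) * (a * c * a * (c + d)) ^ (j + 1)) := by
  have hodd : ∀ j : ℕ, (c + d) * (a * (c + d)) ^ (2 * j + 2) ≤
      (c + d) * (a * c * a * (c + d)) ^ (j + 1) +
        c * a * ((c + d) * (a * c * a * (c + d)) ^ j) * (a * c) →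
      (c + d) * (a * (c + d)) ^ (2 * j + 3) ≤
        (c + d) * (a * c * a * (c + d)) ^ (j + 1) * (a * c) +
        c * a * ((c + d) * (a * c * a * (c + d)) ^ (j + 1)) := by
    intro j hj
    have hd : (c + d) * (a * c * a * (c + d)) ^ (j + 1) * (a * d) ≤
        c * a * ((c + d) * (a * c * a * (c + d)) ^ (j + 1)) := by
      cases j with
      | zero =>
        rw [zero_add, pow_one]
        refine (alt_mul_a_mul_d_le hcd h4).trans ?_
        have e : c * (a * (c * (a * (c * (a * d))))) = c * a * (c * (a * c * a * d)) := by
          simp only [mul_assoc]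
        rw [e]
        gcongr
        · exact le_add_of_nonneg_right zero_le
        · exact le_add_of_nonneg_left zero_le
      | succ j => rw [alt_mul_a_mul_d_eq_zero hcd h3 h4]; exact zero_le
    calc (c + d) * (a * (c + d)) ^ (2 * j + 3)
        = (c + d) * (a * (c + d)) ^ (2 * j + 2) * (a * (c + d)) := by
          rw [show 2 * j + 3 = 2 * j + 2 + 1 from rfl, pow_succ, mul_assoc]
      _ ≤ _ := mul_le_mul_left hj _
      _ = (c + d) * (a * c * a * (c + d)) ^ (j + 1) * (a * c) +
          ((c + d) * (a * c * a * (c + d)) ^ (j + 1) * (a * d) +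
          c * a * ((c + d) * (a * c * a * (c + d)) ^ (j + 1))) := by
        rw [add_mul, mul_add a, mul_add, ← add_assoc]
        congr 1
        rw [pow_succ]
        simp only [mul_assoc, ← mul_add]
      _ ≤ _ := by
        gcongr
        exact add_le hd le_rfl
  have hzero : (c + d) * (a * (c + d)) ^ (2 * 0 + 2) ≤ (c + d) * (a * c * a * (c + d)) ^ (0 + 1) +
      c * a * ((c + d) * (a * c * a * (c + d)) ^ 0) * (a * c) := by
    have e : (c + d) * (a * (c + d)) ^ (2 * 0 + 2) =
        (c + d) * (a * c * a * (c + d)) ^ (0 + 1) + c * a * d * (a * c) := by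
      simp only [mul_zero, zero_add, pow_one, pow_two]
      simp only [mul_add, add_mul, mul_assoc, hdc, hcd, hdd, add_zero]
      abel
    rw [e, pow_zero, mul_one]
    gcongr
    exact le_add_of_nonneg_left zero_le
  induction j with
  | zero => exact ⟨hzero, hodd 0 hzero⟩
  | succ j ih =>
    have hs : (c + d) * (a * (c + d)) ^ (2 * (j + 1) + 2) ≤
        (c + d) * (a * c * a * (c + d)) ^ (j + 1 + 1) +
        c * a * ((c + d) * (a * c * a * (c + d)) ^ (j + 1)) * (a * c) := by
      -- A leading c leaves no room for a d of the wrong parity: even the shortest case now contains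
      -- four c's.
      have hd : c * a * ((c + d) * (a * c * a * (c + d)) ^ (j + 1) * (a * d)) ≤ 0 := by
        cases j with
        | zero =>
          rw [zero_add, pow_one]
          refine (mul_le_mul_right (alt_mul_a_mul_d_le hcd h4) _).trans (le_of_eq ?_)
          simpa [mul_assoc] using congrArg (· * (a * d)) h3
        | succ j => rw [alt_mul_a_mul_d_eq_zero hcd h3 h4, mul_zero]
      calc (c + d) * (a * (c + d)) ^ (2 * (j + 1) + 2)
          = (c + d) * (a * (c + d)) ^ (2 * j + 3) * (a * (c + d)) := by
            rw [show 2 * (j + 1) + 2 = 2 * j + 3 + 1 by ring, pow_succ, mul_assoc]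
        _ ≤ _ := mul_le_mul_left ih.2 _
        _ = (c + d) * (a * c * a * (c + d)) ^ (j + 1 + 1) +
            (c * a * ((c + d) * (a * c * a * (c + d)) ^ (j + 1)) * (a * c) +
            c * a * ((c + d) * (a * c * a * (c + d)) ^ (j + 1) * (a * d))) := by
          rw [add_mul, pow_succ _ (j + 1), ← mul_assoc (c * a) _ (a * d), ← mul_add, ← mul_add]
          simp only [mul_assoc]
        _ ≤ _ := by
          gcongr
          exact (add_le_add le_rfl hd).trans (le_of_eq (add_zero _))
    exact ⟨hs, hodd _ hs⟩

end Semiring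

/-- The pair C, D suits the parity argument, whose relators use only C and D; the pair B, D below
suits the words BAB, BAD, DAB, which exclude DAD. -/
theorem nonASpan_cg_eq : nonASpan k (cg k) = letterSpan k (cg k) .C + letterSpan k (cg k) .D := by
  rw [Submodule.add_eq_sup, ← Submodule.span_union, Set.singleton_union]
  apply le_antisymm
  · rw [nonASpan, Submodule.span_le]
    have h : cg k .B = -(cg k .C + cg k .D) := by
      rw [eq_neg_iff_add_eq_zero, ← add_assoc, cg_add]
    have hC : cg k .C ∈ Submodule.span k {cg k .C, cg k .D} := Submodule.subset_span (by simp)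
    have hD : cg k .D ∈ Submodule.span k {cg k .C, cg k .D} := Submodule.subset_span (by simp)
    rintro x (rfl | rfl | rfl)
    · rw [h]; exact neg_mem (add_mem hC hD)
    · exact hC
    · exact hD
  · exact Submodule.span_mono (by simp)

theorem nonASpan_cg_eq' : nonASpan k (cg k) = Submodule.span k {cg k .B, cg k .D} := by
  apply le_antisymm
  · rw [nonASpan, Submodule.span_le]
    have h : cg k .C = -(cg k .B + cg k .D) := by
      rw [eq_neg_iff_add_eq_zero, ← cg_add (k := k)]; abel
    have hB : cg k .B ∈ Submodule.span k {cg k .B, cg k .D} := Submodule.subset_span (by simp)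
    have hD : cg k .D ∈ Submodule.span k {cg k .B, cg k .D} := Submodule.subset_span (by simp)
    rintro x (rfl | rfl | rfl)
    · exact hB
    · rw [h]; exact neg_mem (add_mem hB hD)
    · exact hD
  · exact Submodule.span_mono (by simp [Set.insert_subset_iff])

variable (k) in
/-- The substitution on `Cover` as a linear map. -/
abbrev sigmaLin : Cover k →ₗ[k] Cover k := (coverSigma k).toLinearMap

theorem altSpan_cg_le (j : ℕ) :
    altSpan k (cg k) (2 * j + 2) ≤ (altSpan k (cg k) (j + 1)).map (sigmaLin k) ⊔
        Submodule.span k {cg k .C * cg k .A} * (altSpan k (cg k) j).map (sigmaLin k) *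
          Submodule.span k {cg k .A * cg k .C} ∧
      altSpan k (cg k) (2 * j + 3) ≤
        (altSpan k (cg k) (j + 1)).map (sigmaLin k) * Submodule.span k {cg k .A * cg k .C} ⊔
        Submodule.span k {cg k .C * cg k .A} * (altSpan k (cg k) (j + 1)).map (sigmaLin k) := by
  have hsub := isSubstitution_coverSigma (k := k)
  have h : ∀ s t, Submodule.span k {cg k s * cg k t} =
      letterSpan k (cg k) s * letterSpan k (cg k) t := fun s t => by
    rw [Submodule.span_mul_span, Set.singleton_mul_singleton]
  rw [map_altSpan hsub, map_altSpan hsub, h, h, altSpan, altSpan, nonASpan_cg_eq,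
    ← Submodule.add_eq_sup, ← Submodule.add_eq_sup]
  apply alt_le <;> simp only [Submodule.span_mul_span, Set.singleton_mul_singleton]
  · rw [cg_DADA (by simp), Submodule.span_zero_singleton]; rfl
  · rw [cg_ADAD (by simp), Submodule.span_zero_singleton]; rfl
  · rw [cg_ADAD (by simp), Submodule.span_zero_singleton]; rfl
  · rw [cg_CACACAC, Submodule.span_zero_singleton]; rfl
  · rw [cg_DACACAD, Submodule.span_zero_singleton]; rfl

/-! ### Alternating words without DAD -/

variable (k) in
/-- The span of `BAB`, `BAD`, `DAB`. -/
def baseSpan : Submodule k (Cover k) :=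
  Submodule.span k {cg k .B * cg k .A * cg k .B, cg k .B * cg k .A * cg k .D,
    cg k .D * cg k .A * cg k .B}

variable (k) in
/-- The span of the alternating words with at least `1` and at most `d` letters `A` which neither
start nor end with `A`, without `DAD`. -/
def posSpan : ℕ → Submodule k (Cover k)
  | 0 => ⊥
  | 1 => baseSpan k
  | d + 2 => posSpan (d + 1) ⊔ altSpan k (cg k) (d + 2)

variable (k) in
/-- The element `DAD`. -/
def dad : Cover k := cg k .D * cg k .A * cg k .D

theorem posSpan_mono : Monotone (posSpan k) := by
  refine monotone_nat_of_le_succ fun n => ?_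
  cases n with
  | zero => exact bot_le
  | succ n => exact le_sup_left

theorem baseSpan_le_posSpan (d : ℕ) : baseSpan k ≤ posSpan k (d + 1) :=
  posSpan_mono (k := k) (Nat.le_add_left 1 d)

theorem altSpan_one_le : altSpan k (cg k) 1 ≤ baseSpan k ⊔ Submodule.span k {dad k} := by
  rw [altSpan, pow_one, nonASpan_cg_eq', Submodule.span_mul_span, Submodule.span_mul_span,
    Submodule.span_le]
  rintro _ ⟨s, hs, _, ⟨a, ha, t, ht, rfl⟩, rfl⟩
  rw [Set.mem_singleton_iff] at ha
  subst ha
  change s * (cg k .A * t) ∈ _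
  rw [← mul_assoc]
  rcases hs with rfl | rfl <;> rcases ht with rfl | rfl
  · exact Submodule.mem_sup_left (Submodule.subset_span (by simp))
  · exact Submodule.mem_sup_left (Submodule.subset_span (by simp))
  · exact Submodule.mem_sup_left (Submodule.subset_span (by simp))
  · exact Submodule.mem_sup_right (Submodule.mem_span_singleton_self _)

theorem altSpan_le_posSpan {m d : ℕ} (hm : 1 ≤ m) (hd : m ≤ d) :
    altSpan k (cg k) m ≤ posSpan k d ⊔ Submodule.span k {dad k} := by
  obtain _ | _ | m := m
  · omega
  · obtain ⟨d, rfl⟩ := Nat.exists_eq_add_of_le' hd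
    exact altSpan_one_le.trans (sup_le_sup_right (baseSpan_le_posSpan d) _)
  · exact le_sup_of_le_left (le_sup_right.trans (posSpan_mono hd))

theorem sigma_dad : sigmaLin k (dad k) = cg k .C * cg k .A * cg k .C * (cg k .A * cg k .C) := by
  have h := isSubstitution_coverSigma (k := k)
  simp [dad, h.1, h.2.2.2, mul_assoc]

/-- The decomposition of alternating words into images of the substitution. -/
theorem posSpan_succ_le (d : ℕ) :
    posSpan k (d + 1) ≤ baseSpan k ⊔ (posSpan k d).map (sigmaLin k) ⊔
      Submodule.span k {cg k .C * cg k .A} * (nonASpan k (cg k) ⊔ posSpan k d).map (sigmaLin k) *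
        Submodule.span k {cg k .A * cg k .C} ⊔
      (posSpan k d).map (sigmaLin k) * Submodule.span k {cg k .A * cg k .C} ⊔
      Submodule.span k {cg k .C * cg k .A} * (posSpan k d).map (sigmaLin k) := by
  set ca := Submodule.span k {cg k .C * cg k .A}
  set ac := Submodule.span k {cg k .A * cg k .C}
  have key : ∀ m, 2 ≤ m → m ≤ d + 1 → altSpan k (cg k) m ≤
      (posSpan k d).map (sigmaLin k) ⊔
      ca * (nonASpan k (cg k) ⊔ posSpan k d).map (sigmaLin k) * ac ⊔
      (posSpan k d).map (sigmaLin k) * ac ⊔ ca * (posSpan k d).map (sigmaLin k) := by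
    intro m hm hd
    have hσ : ∀ j, 1 ≤ j → j ≤ d → (altSpan k (cg k) j).map (sigmaLin k) ≤
        (posSpan k d).map (sigmaLin k) ⊔ Submodule.span k {sigmaLin k (dad k)} := by
      intro j hj hjd
      have := Submodule.map_mono (f := sigmaLin k) (altSpan_le_posSpan (k := k) hj hjd)
      rwa [Submodule.map_sup, Submodule.map_span, Set.image_singleton] at this
    -- The excluded word causes no loss: σ(DAD) = CA·σ(D)·AC, with D a single letter.
    have hdad : Submodule.span k {sigmaLin k (dad k)} ≤
        ca * (nonASpan k (cg k) ⊔ posSpan k d).map (sigmaLin k) * ac := by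
      rw [Submodule.span_singleton_le_iff_mem, sigma_dad]
      refine Submodule.mul_mem_mul (Submodule.mul_mem_mul (Submodule.mem_span_singleton_self _) ?_)
        (Submodule.mem_span_singleton_self _)
      exact ⟨cg k .D, Submodule.mem_sup_left (mem_nonASpan _ (by simp)),
        isSubstitution_coverSigma.2.2.2⟩
    -- With one more AC on the right, or CA on the left, σ(DAD) becomes the relator CACACAC.
    have hr : Submodule.span k {sigmaLin k (dad k)} * ac = ⊥ := by
      rw [Submodule.span_mul_span, Set.singleton_mul_singleton, sigma_dad]
      have := cg_CACACAC (k := k)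
      simp only [mul_assoc] at this ⊢
      rw [this, Submodule.span_zero_singleton]
    have hl : ca * Submodule.span k {sigmaLin k (dad k)} = ⊥ := by
      rw [Submodule.span_mul_span, Set.singleton_mul_singleton, sigma_dad]
      have := cg_CACACAC (k := k)
      simp only [mul_assoc] at this ⊢
      rw [this, Submodule.span_zero_singleton]
    have hmr : ∀ j, 1 ≤ j → j ≤ d → (altSpan k (cg k) j).map (sigmaLin k) * ac ≤
        (posSpan k d).map (sigmaLin k) * ac := fun j hj hjd => by
      refine (mul_le_mul_left (hσ j hj hjd) ac).trans ?_
      rw [← Submodule.add_eq_sup, add_mul, hr, Submodule.add_eq_sup, sup_bot_eq]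
    have hml : ∀ j, 1 ≤ j → j ≤ d → ca * (altSpan k (cg k) j).map (sigmaLin k) ≤
        ca * (posSpan k d).map (sigmaLin k) := fun j hj hjd => by
      refine (mul_le_mul_right (hσ j hj hjd) ca).trans ?_
      rw [← Submodule.add_eq_sup, mul_add, hl, Submodule.add_eq_sup, sup_bot_eq]
    have hmm : ∀ j, j ≤ d → ca * (altSpan k (cg k) j).map (sigmaLin k) * ac ≤
        ca * (nonASpan k (cg k) ⊔ posSpan k d).map (sigmaLin k) * ac := fun j hjd => by
      obtain rfl | hj := Nat.eq_zero_or_pos j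
      · refine mul_le_mul_left (mul_le_mul_right (Submodule.map_mono ?_) _) _
        rw [altSpan, pow_zero, mul_one]
        exact le_sup_left
      · refine mul_le_mul_left ((hml j hj hjd).trans
          (mul_le_mul_right (Submodule.map_mono le_sup_right) _)) _
    -- In both parities σ is applied to words with at most j + 1 letters A, and m ≤ d + 1 gives j +
    -- 1 ≤ d.
    obtain ⟨j, rfl | rfl⟩ : ∃ j, m = 2 * j + 2 ∨ m = 2 * j + 3 := ⟨m / 2 - 1, by omega⟩
    · refine (altSpan_cg_le j).1.trans (sup_le ?_ ?_)
      · exact le_sup_of_le_left (le_sup_of_le_left ((hσ (j + 1) (by omega) (by omega)).trans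
          (sup_le_sup_left hdad _)))
      · exact le_sup_of_le_left (le_sup_of_le_left (le_sup_of_le_right (hmm j (by omega))))
    · refine (altSpan_cg_le j).2.trans (sup_le ?_ ?_)
      · exact le_sup_of_le_left (le_sup_of_le_right (hmr (j + 1) (by omega) (by omega)))
      · exact le_sup_of_le_right (hml (j + 1) (by omega) (by omega))
  rw [sup_assoc, sup_assoc, sup_assoc, ← sup_assoc (a := Submodule.map _ _),
    ← sup_assoc (a := Submodule.map _ _ ⊔ _)]
  have : ∀ n, n ≤ d → posSpan k (n + 1) ≤ baseSpan k ⊔ ((posSpan k d).map (sigmaLin k) ⊔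
      ca * (nonASpan k (cg k) ⊔ posSpan k d).map (sigmaLin k) * ac ⊔
      (posSpan k d).map (sigmaLin k) * ac ⊔ ca * (posSpan k d).map (sigmaLin k)) := by
    intro n hn
    induction n with
    | zero => exact le_sup_left
    | succ n ih =>
      exact sup_le (ih (by omega)) (le_sup_of_le_right (key _ (by omega) (by omega)))
  simpa only [sup_assoc] using this d le_rfl

theorem exists_of_mem_sup {W : Type*} [Ring W] [Algebra k W] {u v b₁ b₂ b₃ x : W}
    {P Q : Submodule k W} {s : W →ₗ[k] W}
    (hx : x ∈ Submodule.span k {b₁, b₂, b₃} ⊔ P.map s ⊔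
      Submodule.span k {u} * Q.map s * Submodule.span k {v} ⊔ P.map s * Submodule.span k {v} ⊔
      Submodule.span k {u} * P.map s) :
    ∃ p q r : k, ∃ f₁ ∈ P, ∃ f₂ ∈ Q, ∃ f₃ ∈ P, ∃ f₄ ∈ P,
      x = p • b₁ + q • b₂ + r • b₃ + s f₁ + u * s f₂ * v + s f₃ * v + u * s f₄ := by
  obtain ⟨y3, hy3, x4, h4, e4⟩ := Submodule.mem_sup.1 hx
  obtain ⟨y2, hy2, x3, h3, e3⟩ := Submodule.mem_sup.1 hy3
  obtain ⟨y1, hy1, x2, h2, e2⟩ := Submodule.mem_sup.1 hy2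
  obtain ⟨y0, hy0, x1, h1, e1⟩ := Submodule.mem_sup.1 hy1
  obtain ⟨p, q, r, e0⟩ := Submodule.mem_span_triple.1 hy0
  obtain ⟨f1, hf1, g1⟩ := Submodule.mem_map.1 h1
  obtain ⟨z2, hz2, g2⟩ := Submodule.mem_mul_span_singleton.1 h2
  obtain ⟨t2, ht2, i2⟩ := Submodule.mem_span_singleton_mul.1 hz2
  obtain ⟨f2, hf2, j2⟩ := Submodule.mem_map.1 ht2
  obtain ⟨z3, hz3, g3⟩ := Submodule.mem_mul_span_singleton.1 h3
  obtain ⟨f3, hf3, i3⟩ := Submodule.mem_map.1 hz3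
  obtain ⟨z4, hz4, g4⟩ := Submodule.mem_span_singleton_mul.1 h4
  obtain ⟨f4, hf4, i4⟩ := Submodule.mem_map.1 hz4
  exact ⟨p, q, r, f1, hf1, f2, hf2, f3, hf3, f4, hf4, by
    rw [e0, g1, j2, i2, g2, i3, g3, i4, g4, e1, e2, e3, e4]⟩

theorem exists_of_mem_posSpan_succ {d : ℕ} {x : Cover k} (hx : x ∈ posSpan k (d + 1)) :
    ∃ p q r : k, ∃ f₁ ∈ posSpan k d, ∃ f₂ ∈ nonASpan k (cg k) ⊔ posSpan k d,
      ∃ f₃ ∈ posSpan k d, ∃ f₄ ∈ posSpan k d,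
      x = p • (cg k .B * cg k .A * cg k .B) + q • (cg k .B * cg k .A * cg k .D) +
        r • (cg k .D * cg k .A * cg k .B) + coverSigma k f₁ +
        cg k .C * cg k .A * coverSigma k f₂ * (cg k .A * cg k .C) +
        coverSigma k f₃ * (cg k .A * cg k .C) + cg k .C * cg k .A * coverSigma k f₄ :=
  exists_of_mem_sup (posSpan_succ_le d hx)

/-! ### Separation of the types of words -/

/-- The sum of the scalars, `k A`, `Y`, `A Z`, `Z A` and `A Z A` is direct, and multiplication by
`A` is injective on `Z`. -/
def IsSeparated (Y Z : Submodule k (Module.End k (BoundarySpace k))) : Prop :=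
  ∀ (α β : k), ∀ x₁ ∈ Y, ∀ x₂ ∈ Z, ∀ x₃ ∈ Z, ∀ x₄ ∈ Z,
    α • 1 + β • op k .A + x₁ + op k .A * x₂ + x₃ * op k .A + op k .A * x₄ * op k .A = 0 →
    α = 0 ∧ β = 0 ∧ x₁ = 0 ∧ x₂ = 0 ∧ x₃ = 0 ∧ x₄ = 0

/-- Multiplication by A adds up rows or columns, so each matrix entry of the relation is again a sum
of the six types, to which `h` applies. -/
theorem isSeparated_of_block [CharP k 2] {X Y Z : Submodule k (Module.End k (BoundarySpace k))}
    (h : IsSeparated Y Z)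
    (hX : ∀ x ∈ X, ∃ c : k, ∃ u ∈ Z, ∃ v ∈ Z, ∃ w ∈ Z, ∃ z ∈ Y,
      block k x = !![c • op k .A + op k .A * u * op k .A, op k .A * v; w * op k .A, z]) :
    IsSeparated X X := by
  intro α β x₁ h₁ x₂ h₂ x₃ h₃ x₄ h₄ e
  obtain ⟨c1, u1, hu1, v1, hv1, w1, hw1, z1, hz1, e1⟩ := hX x₁ h₁
  obtain ⟨c2, u2, hu2, v2, hv2, w2, hw2, z2, hz2, e2⟩ := hX x₂ h₂
  obtain ⟨c3, u3, hu3, v3, hv3, w3, hw3, z3, hz3, e3⟩ := hX x₃ h₃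
  obtain ⟨c4, u4, hu4, v4, hv4, w4, hw4, z4, hz4, e4⟩ := hX x₄ h₄
  have E := congrArg (block k) e
  simp only [map_add, map_mul, map_smul, map_one, map_zero, block_op_A, e1, e2, e3, e4,
    Matrix.mul_fin_two, Matrix.one_fin_two] at E
  have E11 := congrFun (congrFun E 0) 0
  have E12 := congrFun (congrFun E 0) 1
  have E21 := congrFun (congrFun E 1) 0
  have E22 := congrFun (congrFun E 1) 1
  simp at E11 E12 E21 E22
  obtain ⟨a1, a2, a3, a4, a5, a6⟩ := h (α + β) (c1 + c2 + c3 + c4) z4 hz4 (v3 + v4)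
    (add_mem hv3 hv4) (w2 + w4) (add_mem hw2 hw4) (u1 + u2 + u3 + u4)
    (add_mem (add_mem (add_mem hu1 hu2) hu3) hu4) (by
      rw [← E11]; simp only [mul_add, add_mul, add_smul]; abel)
  obtain ⟨b1, b2, b3, b4, b5, b6⟩ := h β (c3 + c4) (z2 + z4) (add_mem hz2 hz4) (v1 + v2 + v3 + v4)
    (add_mem (add_mem (add_mem hv1 hv2) hv3) hv4) w4 hw4 (u3 + u4) (add_mem hu3 hu4) (by
      rw [← E12]; simp only [mul_add, add_mul, add_smul]; abel)
  obtain ⟨d1, d2, d3, d4, d5, d6⟩ := h β (c2 + c4) (z3 + z4) (add_mem hz3 hz4) v4 hv4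
    (w1 + w2 + w3 + w4) (add_mem (add_mem (add_mem hw1 hw2) hw3) hw4) (u2 + u4)
    (add_mem hu2 hu4) (by
      rw [← E21]; simp only [mul_add, add_mul, add_smul]; abel)
  obtain ⟨f1, f2, f3, f4, f5, f6⟩ := h (α + β) c4 (z1 + z2 + z3 + z4)
    (add_mem (add_mem (add_mem hz1 hz2) hz3) hz4) (v2 + v4) (add_mem hv2 hv4) (w3 + w4)
    (add_mem hw3 hw4) u4 hu4 (by
      rw [← E22]; simp only [mul_add, add_mul, add_smul]; abel)
  -- The 24 resulting equations form a triangular system: the components of x₄ stand alone and go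
  -- first, then those of x₂ and x₃, then those of x₁.
  subst a3 f6 f2 d4 b5 b1
  simp only [add_zero] at *
  subst b3 d3 b2 d2 d6 b6 a4 a5 f4 f5 a1
  simp only [add_zero] at *
  subst a2 a6 b4 d5 f3
  have hz : ∀ x, block k x = !![0, 0; 0, 0] → x = 0 := fun x hx => block_injective (by
    rw [hx, map_zero]; exact (matrix_eq_of (k := k) 0 rfl rfl rfl rfl).symm)
  simp only [zero_smul, mul_zero, zero_mul, add_zero] at e1 e2 e3 e4
  exact ⟨trivial, trivial, hz _ e1, hz _ e2, hz _ e3, hz _ e4⟩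

instance : Nontrivial (BoundarySpace k) :=
  (BoundarySpace.basis k).repr.toEquiv.nontrivial

theorem smul_op_A_eq_zero [CharP k 2] {α c : k} (h : α • 1 + c • op k .A = 0) :
    α = 0 ∧ c = 0 := by
  have E := congrArg (block k) h
  simp only [map_add, map_smul, map_one, block_op_A, map_zero] at E
  have E11 := congrFun (congrFun E 0) 0
  have E12 := congrFun (congrFun E 0) 1
  simp at E11 E12
  subst E12
  exact ⟨by simpa using E11, rfl⟩

theorem generators_linearIndependent [CharP k 2] {α β γ δ : k}
    (h : α • 1 + β • op k .A + (γ • op k .B + δ • op k .D) = 0) :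
    α = 0 ∧ β = 0 ∧ γ = 0 ∧ δ = 0 := by
  have E := congrArg (block k) h
  simp only [map_add, map_smul, map_one, block_op_A, block_op_B, block_op_D, map_zero] at E
  have E11 := congrFun (congrFun E 0) 0
  have E12 := congrFun (congrFun E 0) 1
  have E22 := congrFun (congrFun E 1) 1
  simp at E11 E12 E22
  subst E12
  rw [zero_smul, add_zero] at E11
  obtain ⟨rfl, rfl⟩ := smul_op_A_eq_zero E11
  simp only [zero_smul, zero_add] at E22
  have F := congrFun (congrFun (congrArg (block k) E22) 0) 0
  rw [map_smul, block_op_B, map_zero] at F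
  simp only [Matrix.smul_apply, Matrix.of_apply, Matrix.cons_val', Matrix.cons_val_zero,
    Matrix.zero_apply] at F
  exact ⟨rfl, rfl, rfl, (smul_op_A_eq_zero (α := 0) (by simpa using F)).2⟩

variable (k) in
/-- The span of the alternating words with at most `d` letters `A` which neither start nor end with
`A`, without `DAD`. -/
def redSpan (d : ℕ) : Submodule k (Cover k) := nonASpan k (cg k) ⊔ posSpan k d

variable (k) in
/-- The image of `redSpan` in the endomorphisms of `k X^ω`. -/
def opSpan [CharP k 2] (d : ℕ) : Submodule k (Module.End k (BoundarySpace k)) :=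
  (redSpan k d).map (coverOp k).toLinearMap

theorem exists_of_mem_nonASpan {x : Cover k} (hx : x ∈ nonASpan k (cg k)) :
    ∃ γ δ : k, x = γ • cg k .B + δ • cg k .D := by
  rw [nonASpan_cg_eq', Submodule.mem_span_pair] at hx
  obtain ⟨γ, δ, rfl⟩ := hx
  exact ⟨γ, δ, rfl⟩

theorem block_nonA [CharP k 2] (γ δ : k) :
    block k (coverOp k (γ • cg k .B + δ • cg k .D)) =
      !![γ • op k .A, 0; 0, coverOp k (γ • cg k .C + δ • cg k .B)] := by
  simp [coverOp_cg, block_op_B, block_op_D]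

/-- BAB, BAD and DAB still lift, though they have one letter A. DAD does not: CACAC has the entry
ADA on the first branch. -/
theorem posSpan_le_liftSubmodule [CharP k 2] (d : ℕ) :
    posSpan k d ≤ liftSubmodule (coverOp k) (coverSigma k) := by
  have hs := isSubstitution_coverSigma (k := k)
  induction d with
  | zero => exact bot_le
  | succ d ih =>
    cases d with
    | zero =>
      refine Submodule.span_le.2 ?_
      have hA := op_A_mul_A (k := k)
      have hA' : ∀ z, op k .A * (op k .A * z) = 0 := fun z => by rw [← mul_assoc, hA, zero_mul]
      rintro _ (rfl | rfl | rfl) <;>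
      · change block k _ = _
        simp only [map_mul, hs.1, hs.2.1, hs.2.2.2, coverOp_cg, block_op_A, block_op_C, block_op_D,
          Matrix.mul_fin_two]
        refine matrix_eq_of _ ?_ ?_ ?_ ?_ <;>
          simp [mul_add, op_mul_op, mul_assoc, hA]
    | succ d => exact sup_le ih (altSpan_le_liftSubmodule coverOp_cg hs d)

theorem posSpan_mul_op [CharP k 2] (d : ℕ) {x : Cover k} (hx : x ∈ posSpan k d) :
    op k .D * coverOp k x = 0 ∧ coverOp k x * op k .D = 0 := by
  have hl : ∀ u ∈ nonASpan k (cg k), ∀ y, op k .D * coverOp k (u * y) = 0 := fun u hu y => by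
    rw [map_mul, ← mul_assoc, (mul_eq_zero_of_nonASpan coverOp_cg hu .D (by simp)).2, zero_mul]
  have hr : ∀ u ∈ nonASpan k (cg k), ∀ y, coverOp k (y * u) * op k .D = 0 := fun u hu y => by
    rw [map_mul, mul_assoc, (mul_eq_zero_of_nonASpan coverOp_cg hu .D (by simp)).1, mul_zero]
  let L : Submodule k (Cover k) :=
    LinearMap.ker (LinearMap.mulLeft k (op k .D) ∘ₗ (coverOp k).toLinearMap) ⊓
      LinearMap.ker (LinearMap.mulRight k (op k .D) ∘ₗ (coverOp k).toLinearMap)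
  suffices h : posSpan k d ≤ L from h hx
  clear hx x
  have hN : ∀ P Q : Submodule k (Cover k), nonASpan k (cg k) * P = Q * nonASpan k (cg k) →
      nonASpan k (cg k) * P ≤ L := by
    intro P Q h
    refine le_inf ?_ ?_
    · rw [Submodule.mul_le]
      exact fun u hu y _ => hl u hu y
    · rw [h, Submodule.mul_le]
      exact fun y _ u hu => hr u hu y
  have hB : cg k .B ∈ nonASpan k (cg k) := mem_nonASpan _ (by simp)
  have hD : cg k .D ∈ nonASpan k (cg k) := mem_nonASpan _ (by simp)
  induction d with
  | zero => exact bot_le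
  | succ d ih =>
    cases d with
    | zero =>
      refine Submodule.span_le.2 ?_
      rintro _ (rfl | rfl | rfl)
      · exact ⟨by simpa [mul_assoc] using hl _ hB (cg k .A * cg k .B), hr _ hB _⟩
      · exact ⟨by simpa [mul_assoc] using hl _ hB (cg k .A * cg k .D), hr _ hD _⟩
      · exact ⟨by simpa [mul_assoc] using hl _ hD (cg k .A * cg k .B), hr _ hB _⟩
    | succ d =>
      refine sup_le ih (hN _ (nonASpan k (cg k) * (letterSpan k (cg k) .A * nonASpan k (cg k)) ^
        (d + 1) * letterSpan k (cg k) .A) ?_)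
      rw [pow_succ]
      simp only [mul_assoc]

theorem exists_block_substitution [CharP k 2] {d : ℕ} {x : Cover k} (hx : x ∈ redSpan k d) :
    ∃ p : k, block k (coverOp k (coverSigma k x)) = !![p • op k .A, 0; 0, coverOp k x] ∧
      op k .D * coverOp k x = 0 ∧ coverOp k x * op k .D = 0 := by
  obtain ⟨u, hu, f, hf, rfl⟩ := Submodule.mem_sup.1 hx
  obtain ⟨p, hp⟩ := block_substitution_nonA coverOp_cg isSubstitution_coverSigma hu
  obtain ⟨h1, h2⟩ := mul_eq_zero_of_nonASpan coverOp_cg hu .D (by simp)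
  obtain ⟨h3, h4⟩ := posSpan_mul_op d hf
  have h5 : block k _ = _ := posSpan_le_liftSubmodule d hf
  exact ⟨p, by simp [hp, h5], by simp [mul_add, h2, h3], by simp [add_mul, h1, h4]⟩

/-- The substitution puts each `fᵢ` in the lower right corner. A factor CA on the left moves it to
the upper row as A f, a factor AC on the right moves it to the left column as f A; the leftovers
contain D f, f D, A² or DAD. The words BAB, BAD, DAB contribute only off the diagonal. -/
theorem block_of_mem_redSpan [CharP k 2] {d : ℕ} {x : Cover k} (hx : x ∈ redSpan k (d + 1)) :
    ∃ γ δ p q r : k, ∃ f₁ ∈ posSpan k d, ∃ f₂ ∈ redSpan k d,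
      ∃ f₃ ∈ posSpan k d, ∃ f₄ ∈ posSpan k d,
      x = γ • cg k .B + δ • cg k .D +
        (p • (cg k .B * cg k .A * cg k .B) + q • (cg k .B * cg k .A * cg k .D) +
        r • (cg k .D * cg k .A * cg k .B) + coverSigma k f₁ +
        cg k .C * cg k .A * coverSigma k f₂ * (cg k .A * cg k .C) +
        coverSigma k f₃ * (cg k .A * cg k .C) + cg k .C * cg k .A * coverSigma k f₄) ∧
      block k (coverOp k x) = !![γ • op k .A + op k .A * coverOp k f₂ * op k .A,
        op k .A * coverOp k (p • cg k .C + q • cg k .B + f₄);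
        coverOp k (p • cg k .C + r • cg k .B + f₃) * op k .A,
        coverOp k (γ • cg k .C + δ • cg k .B + f₁)] := by
  obtain ⟨u, hu, f, hf, rfl⟩ := Submodule.mem_sup.1 hx
  obtain ⟨γ, δ, rfl⟩ := exists_of_mem_nonASpan hu
  obtain ⟨p, q, r, f₁, h₁, f₂, h₂, f₃, h₃, f₄, h₄, rfl⟩ := exists_of_mem_posSpan_succ hf
  refine ⟨γ, δ, p, q, r, f₁, h₁, f₂, h₂, f₃, h₃, f₄, h₄, rfl, ?_⟩
  have e1 : block k _ = _ := posSpan_le_liftSubmodule d h₁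
  have e3 : block k _ = _ := posSpan_le_liftSubmodule d h₃
  have e4 : block k _ = _ := posSpan_le_liftSubmodule d h₄
  obtain ⟨s, e2, a1, a2⟩ := exists_block_substitution h₂
  obtain ⟨-, a3⟩ := posSpan_mul_op d h₃
  obtain ⟨a4, -⟩ := posSpan_mul_op d h₄
  have hA := op_A_mul_A (k := k)
  have hD := op_D_mul_A_mul_D (k := k)
  rw [mul_assoc] at hD
  have a1' : ∀ z, op k .D * (coverOp k f₂ * z) = 0 := fun z => by rw [← mul_assoc, a1, zero_mul]
  rw [map_add, map_add, block_nonA]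
  simp only [map_add, map_mul, map_smul, e1, e2, e3, e4, coverOp_cg, block_op_A, block_op_B,
    block_op_C, block_op_D, Matrix.mul_fin_two]
  refine matrix_eq_of _ ?_ ?_ ?_ ?_ <;>
    simp [mul_add, add_mul, mul_assoc, hA, hD, a1', a2, a3, a4, op_mul_op]

theorem isSeparated_opSpan [CharP k 2] (d : ℕ) : IsSeparated (opSpan k d) (opSpan k d) := by
  have hmem : ∀ {x d}, x ∈ redSpan k d → coverOp k x ∈ opSpan k d := fun h => ⟨_, h, rfl⟩
  have hU : ∀ (s t : Letter) (a b : k), s ≠ .A → t ≠ .A →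
      a • cg k s + b • cg k t ∈ nonASpan k (cg k) := fun s t a b hs ht =>
    add_mem (Submodule.smul_mem _ _ (mem_nonASpan _ hs)) (Submodule.smul_mem _ _ (mem_nonASpan _ ht))
  induction d with
  | zero =>
    -- With Z = 0, separation is the linear independence of 1, A, B, D.
    refine isSeparated_of_block (Y := opSpan k 0) (Z := ⊥) ?_ ?_
    · rintro α β _ ⟨x, hx, rfl⟩ x₂ h₂ x₃ h₃ x₄ h₄ e
      rw [Submodule.mem_bot] at h₂ h₃ h₄
      subst h₂ h₃ h₄
      rw [redSpan, posSpan, sup_bot_eq] at hx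
      obtain ⟨γ, δ, rfl⟩ := exists_of_mem_nonASpan hx
      obtain ⟨rfl, rfl, rfl, rfl⟩ := generators_linearIndependent (α := α) (β := β) (γ := γ) (δ := δ)
        (by simpa [coverOp_cg] using e)
      simp
    · rintro _ ⟨x, hx, rfl⟩
      rw [redSpan, posSpan, sup_bot_eq] at hx
      obtain ⟨γ, δ, rfl⟩ := exists_of_mem_nonASpan hx
      exact ⟨γ, 0, zero_mem _, 0, zero_mem _, 0, zero_mem _, _,
        hmem (Submodule.mem_sup_left (hU .C .B γ δ (by simp) (by simp))),
        (block_nonA γ δ).trans (by simp)⟩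
  | succ d ih =>
    refine isSeparated_of_block ih ?_
    rintro _ ⟨x, hx, rfl⟩
    obtain ⟨γ, δ, p, q, r, f₁, h₁, f₂, h₂, f₃, h₃, f₄, h₄, -, h⟩ := block_of_mem_redSpan hx
    exact ⟨γ, _, hmem h₂,
      _, hmem (add_mem (Submodule.mem_sup_left (hU .C .B p q (by simp) (by simp)))
        (Submodule.mem_sup_right h₄)),
      _, hmem (add_mem (Submodule.mem_sup_left (hU .C .B p r (by simp) (by simp)))
        (Submodule.mem_sup_right h₃)),
      _, hmem (add_mem (Submodule.mem_sup_left (hU .C .B γ δ (by simp) (by simp)))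
        (Submodule.mem_sup_right h₁)), h⟩

/-! ### Word length and faithfulness on alternating words without DAD -/

section Words
variable {W : Type*} [Ring W] [Algebra k W]

theorem wordSpan_mul_le (g : Letter → W) (m n : ℕ) :
    wordSpan k g m * wordSpan k g n ≤ wordSpan k g (m + n) := by
  rw [wordSpan, wordSpan, Submodule.span_mul_span, Submodule.span_le]
  rintro _ ⟨_, ⟨v, rfl, rfl⟩, _, ⟨w, rfl, rfl⟩, rfl⟩
  exact Submodule.subset_span ⟨v ++ w, by simp, by simp⟩

theorem gen_mem_wordSpan (g : Letter → W) (s : Letter) : g s ∈ wordSpan k g 1 :=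
  Submodule.subset_span ⟨[s], rfl, by simp⟩

theorem nonASpan_le_wordSpan (g : Letter → W) : nonASpan k g ≤ wordSpan k g 1 := by
  refine Submodule.span_le.2 ?_
  rintro _ (rfl | rfl | rfl) <;> exact gen_mem_wordSpan g _

theorem altSpan_le_wordSpan (g : Letter → W) (m : ℕ) :
    altSpan k g m ≤ wordSpan k g (2 * m + 1) := by
  induction m with
  | zero => rw [altSpan, pow_zero, mul_one]; exact nonASpan_le_wordSpan g
  | succ m ih =>
    rw [altSpan, pow_succ, ← mul_assoc]
    have h : letterSpan k g .A ≤ wordSpan k g 1 :=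
      (Submodule.span_singleton_le_iff_mem _ _).2 (gen_mem_wordSpan g _)
    calc _ ≤ wordSpan k g (2 * m + 1) * (wordSpan k g 1 * wordSpan k g 1) := by
          gcongr
          · exact ih
          · exact nonASpan_le_wordSpan g
      _ ≤ wordSpan k g (2 * m + 1) * wordSpan k g 2 := by
          gcongr
          exact wordSpan_mul_le g 1 1
      _ ≤ _ := wordSpan_mul_le g _ _

end Words

/-- The letter part has degree 1, the other part has degree at least 3, and `Cover` is graded. -/
theorem eq_zero_of_add_posSpan {d : ℕ} {u f : Cover k} (hu : u ∈ nonASpan k (cg k))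
    (hf : f ∈ posSpan k d) (h : u + f = 0) : u = 0 ∧ f = 0 := by
  obtain ⟨Δ, hΔ⟩ := Presented.exists_isDegreeHom (R := coverRelators k)
    fun _ => exists_wordSpan_of_mem_coverRelators
  have hu' : (Δ u).coeff 1 = u := by
    rw [hΔ.apply_of_mem (nonASpan_le_wordSpan (k := k) (cg k) hu)]
    simp
  have hf' : (Δ f).coeff 1 = 0 := by
    suffices hle : posSpan k d ≤ LinearMap.ker ((Polynomial.lcoeff (Cover k) 1).restrictScalars k ∘ₗ
        Δ.toLinearMap) from hle hf
    have hw : ∀ n, n ≠ 1 → wordSpan k (cg k) n ≤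
        LinearMap.ker ((Polynomial.lcoeff (Cover k) 1).restrictScalars k ∘ₗ Δ.toLinearMap) := by
      intro n hn x hx
      change (Δ x).coeff 1 = 0
      rw [hΔ.apply_of_mem hx, Polynomial.coeff_C_mul_X_pow, if_neg hn.symm]
    clear hf h
    induction d with
    | zero => exact bot_le
    | succ d ih =>
      cases d with
      | zero =>
        refine le_trans ?_ (hw 3 (by simp))
        refine Submodule.span_le.2 ?_
        rintro _ (rfl | rfl | rfl)
        · exact Submodule.subset_span ⟨[.B, .A, .B], rfl, by simp [mul_assoc]⟩
        · exact Submodule.subset_span ⟨[.B, .A, .D], rfl, by simp [mul_assoc]⟩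
        · exact Submodule.subset_span ⟨[.D, .A, .B], rfl, by simp [mul_assoc]⟩
      | succ d => exact sup_le ih ((altSpan_le_wordSpan _ _).trans (hw _ (by omega)))
  have h0 : u = 0 := by
    have := congrArg (fun x => (Δ x).coeff 1) h
    simpa [hu', hf'] using this
  exact ⟨h0, by simpa [h0] using h⟩

theorem coverOp_eq_zero [CharP k 2] (d : ℕ) {x : Cover k} (hx : x ∈ redSpan k d)
    (h : coverOp k x = 0) : x = 0 := by
  have hU : ∀ (s t : Letter) (a b : k), s ≠ .A → t ≠ .A →
      a • cg k s + b • cg k t ∈ nonASpan k (cg k) := fun s t a b hs ht =>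
    add_mem (Submodule.smul_mem _ _ (mem_nonASpan _ hs)) (Submodule.smul_mem _ _ (mem_nonASpan _ ht))
  have hC : cg k .C = -(cg k .B + cg k .D) := by
    rw [eq_neg_iff_add_eq_zero, ← cg_add (k := k)]; abel
  have hCB : ∀ a b : k, a • cg k .C + b • cg k .B = 0 → a = 0 ∧ b = 0 := by
    intro a b e
    have e' := congrArg (coverOp k) e
    rw [hC] at e'
    obtain ⟨-, -, h1, h2⟩ := generators_linearIndependent (k := k) (α := 0) (β := 0) (γ := b - a)
      (δ := -a) (by
        rw [map_zero] at e'
        rw [← e']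
        simp [coverOp_cg, sub_smul]
        abel)
    rw [neg_eq_zero] at h2
    subst h2
    exact ⟨rfl, by simpa using h1⟩
  induction d generalizing x with
  | zero =>
    rw [redSpan, posSpan, sup_bot_eq] at hx
    obtain ⟨γ, δ, rfl⟩ := exists_of_mem_nonASpan hx
    obtain ⟨-, -, rfl, rfl⟩ := generators_linearIndependent (k := k) (α := 0) (β := 0) (γ := γ)
      (δ := δ) (by simpa [coverOp_cg] using h)
    simp
  | succ d ih =>
    have S := isSeparated_opSpan (k := k) d
    have hmem : ∀ {x}, x ∈ redSpan k d → coverOp k x ∈ opSpan k d := fun h => ⟨_, h, rfl⟩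
    obtain ⟨γ, δ, p, q, r, f₁, h₁, f₂, h₂, f₃, h₃, f₄, h₄, rfl, E⟩ := block_of_mem_redSpan hx
    rw [h, map_zero] at E
    have E11 := congrFun (congrFun E 0) 0
    have E12 := congrFun (congrFun E 0) 1
    have E21 := congrFun (congrFun E 1) 0
    have E22 := congrFun (congrFun E 1) 1
    simp only [Matrix.zero_apply, Matrix.of_apply, Matrix.cons_val', Matrix.cons_val_zero,
      Matrix.cons_val_one, Matrix.cons_val_fin_one] at E11 E12 E21 E22
    have m1 := add_mem (Submodule.mem_sup_left (hU .C .B γ δ (by simp) (by simp)))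
        (Submodule.mem_sup_right h₁)
    have m3 := add_mem (Submodule.mem_sup_left (hU .C .B p r (by simp) (by simp)))
        (Submodule.mem_sup_right h₃)
    have m4 := add_mem (Submodule.mem_sup_left (hU .C .B p q (by simp) (by simp)))
        (Submodule.mem_sup_right h₄)
    -- The four entries are γA + A f₂ A, A (pC + qB + f₄), (pC + rB + f₃) A and γC + δB + f₁.
    -- Separation strips the outer A's, the induction hypothesis lifts the vanishing to `Cover`, and
    -- degrees then split letters from longer words.
    obtain ⟨-, -, -, -, -, e2⟩ := S 0 γ 0 (zero_mem _) 0 (zero_mem _) 0 (zero_mem _) _ (hmem h₂)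
      (by rw [add_zero, zero_mul, mul_zero, add_zero, add_zero, zero_smul, zero_add]; exact E11.symm)
    obtain ⟨-, -, -, e4, -, -⟩ := S 0 0 0 (zero_mem _) _ (hmem m4) 0 (zero_mem _) 0 (zero_mem _)
      (by rw [← E12]; simp)
    obtain ⟨-, -, -, -, e3, -⟩ := S 0 0 0 (zero_mem _) 0 (zero_mem _) _ (hmem m3) 0 (zero_mem _)
      (by rw [← E21]; simp)
    obtain ⟨g1, rfl⟩ := eq_zero_of_add_posSpan (hU _ _ _ _ (by simp) (by simp)) h₁ (ih m1 E22.symm)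
    obtain ⟨g3, rfl⟩ := eq_zero_of_add_posSpan (hU _ _ _ _ (by simp) (by simp)) h₃ (ih m3 e3)
    obtain ⟨g4, rfl⟩ := eq_zero_of_add_posSpan (hU _ _ _ _ (by simp) (by simp)) h₄ (ih m4 e4)
    obtain rfl := ih h₂ e2
    obtain ⟨rfl, rfl⟩ := hCB _ _ g1
    obtain ⟨rfl, rfl⟩ := hCB _ _ g3
    obtain ⟨-, rfl⟩ := hCB _ _ g4
    simp

/-! ### Injectivity of the action of the presented algebra -/

section Semiring
variable {S : Type*} [IdemSemiring S]

/-- The normal forms are stable under left multiplication by every generator, hence, containing 1,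
they exhaust the algebra. Here `N` stands for the alternating words that begin and end outside A. -/
theorem add_mul_normal_le {a u N : S} (haa : a * a = 0) (hu : u ≤ N)
    (huN : u * N = 0) (hN : u * a * N ≤ N) :
    (a + u) * (1 + a + N + a * N + N * a + a * N * a) ≤
      1 + a + N + a * N + N * a + a * N * a := by
  have e : (a + u) * (1 + a + N + a * N + N * a + a * N * a) =
      a + u + a * N + u * a * N + a * N * a + (u * a + u * a * N * a) := by
    have haa' : ∀ z, a * (a * z) = 0 := fun z => by rw [← mul_assoc, haa, zero_mul]
    have huN' : ∀ z, u * (N * z) = 0 := fun z => by rw [← mul_assoc, huN, zero_mul]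
    simp only [mul_add, add_mul, mul_assoc, haa, haa', huN, huN', mul_one, add_zero, zero_add]
    abel
  have hua : u * a + u * a * N * a ≤ N * a := by
    rw [← add_mul]
    exact mul_le_mul_left (add_le hu hN) a
  rw [e]
  simp only [add_eq_sup]
  simp only [add_eq_sup] at hua
  refine sup_le (sup_le (sup_le (sup_le (sup_le ?_ ?_) ?_) ?_) ?_) (hua.trans ?_)
  · exact le_sup_of_le_left (le_sup_of_le_left (le_sup_of_le_left (le_sup_of_le_left le_sup_right)))
  · exact hu.trans (le_sup_of_le_left (le_sup_of_le_left (le_sup_of_le_left le_sup_right)))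
  · exact le_sup_of_le_left (le_sup_of_le_left le_sup_right)
  · exact hN.trans (le_sup_of_le_left (le_sup_of_le_left (le_sup_of_le_left le_sup_right)))
  · exact le_sup_right
  · exact le_sup_of_le_left le_sup_right

end Semiring

theorem nonASpan_cg_mul_self : nonASpan k (cg k) * nonASpan k (cg k) = 0 := by
  rw [nonASpan, Submodule.span_mul_span, Submodule.zero_eq_bot, Submodule.span_eq_bot]
  rintro _ ⟨_, rfl | rfl | rfl, _, rfl | rfl | rfl, rfl⟩ <;> exact cg_mul_cg (by simp) (by simp)

theorem nonASpan_mul_altSpan (m : ℕ) : nonASpan k (cg k) * altSpan k (cg k) m = 0 := by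
  rw [altSpan, ← mul_assoc, nonASpan_cg_mul_self, zero_mul]

theorem cover_normal_eq_top :
    (1 : Submodule k (Cover k)) + letterSpan k (cg k) .A + (⨆ m, altSpan k (cg k) m) +
      letterSpan k (cg k) .A * (⨆ m, altSpan k (cg k) m) +
      (⨆ m, altSpan k (cg k) m) * letterSpan k (cg k) .A +
      letterSpan k (cg k) .A * (⨆ m, altSpan k (cg k) m) * letterSpan k (cg k) .A = ⊤ := by
  have H := add_mul_normal_le (a := letterSpan k (cg k) .A) (u := nonASpan k (cg k))
    (N := ⨆ m, altSpan k (cg k) m)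
    (by rw [Submodule.span_mul_span, Set.singleton_mul_singleton, cg_A_mul_A,
      Submodule.span_zero_singleton]; rfl)
    (le_iSup_of_le 0 (by rw [altSpan, pow_zero, mul_one]))
    (by simp only [Submodule.mul_iSup, nonASpan_mul_altSpan, Submodule.zero_eq_bot, iSup_bot])
    (by
      rw [Submodule.mul_iSup]
      refine iSup_le fun m => le_iSup_of_le (m + 1) ?_
      rw [altSpan, altSpan, pow_succ' _ m]
      simp only [mul_assoc, le_refl])
  set T := (1 : Submodule k (Cover k)) + letterSpan k (cg k) .A + (⨆ m, altSpan k (cg k) m) +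
      letterSpan k (cg k) .A * (⨆ m, altSpan k (cg k) m) +
      (⨆ m, altSpan k (cg k) m) * letterSpan k (cg k) .A +
      letterSpan k (cg k) .A * (⨆ m, altSpan k (cg k) m) * letterSpan k (cg k) .A with hT
  have h1 : (1 : Cover k) ∈ T := by
    have : (1 : Submodule k (Cover k)) ≤ T := by
      rw [hT]
      simp only [Submodule.add_eq_sup, sup_assoc]
      exact le_sup_left
    exact this (Submodule.one_le.1 le_rfl)
  have hmul : ∀ s, ∀ x ∈ T, cg k s * x ∈ T := by
    intro s x hx
    refine H (Submodule.mul_mem_mul ?_ hx)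
    cases s
    · exact Submodule.mem_sup_left (Submodule.mem_span_singleton_self _)
    all_goals exact Submodule.mem_sup_right (mem_nonASpan _ (by simp))
  rw [eq_top_iff]
  rintro x -
  obtain ⟨y, rfl⟩ := Presented.mk_surjective x
  suffices h : ∀ z ∈ T, Presented.mk k _ y * z ∈ T by simpa using h 1 h1
  induction y using FreeAlgebra.induction with
  | grade0 r =>
    intro z hz
    rw [AlgHom.commutes, ← Algebra.smul_def]
    exact Submodule.smul_mem _ _ hz
  | grade1 s => exact hmul s
  | mul a b ha hb =>
    intro z hz
    rw [map_mul, mul_assoc]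
    exact ha _ (hb _ hz)
  | add a b ha hb =>
    intro z hz
    rw [map_add, add_mul]
    exact add_mem (ha z hz) (hb z hz)

theorem redSpan_mono : Monotone (redSpan k) := fun _ _ h => sup_le_sup_left (posSpan_mono h) _

theorem exists_of_mem_iSup_altSpan {x : Cover k} (hx : x ∈ ⨆ m, altSpan k (cg k) m) :
    ∃ d, ∃ y ∈ redSpan k d, ∃ c : k, x = y + c • dad k := by
  have h : (⨆ m, altSpan k (cg k) m) ≤ (⨆ d, redSpan k d) ⊔ Submodule.span k {dad k} := by
    refine iSup_le fun m => ?_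
    obtain rfl | hm := Nat.eq_zero_or_pos m
    · refine le_sup_of_le_left (le_iSup_of_le 0 ?_)
      rw [altSpan, pow_zero, mul_one]
      exact le_sup_left
    · exact (altSpan_le_posSpan hm le_rfl).trans
        (sup_le_sup_right (le_sup_right.trans (le_iSup (redSpan k) m)) _)
  obtain ⟨y, hy, z, hz, e⟩ := Submodule.mem_sup.1 (h hx)
  obtain ⟨d, hd⟩ := (Submodule.mem_iSup_of_directed (redSpan k) redSpan_mono.directed_le).1 hy
  obtain ⟨c, hc⟩ := Submodule.mem_span_singleton.1 hz
  exact ⟨d, y, hd, c, by rw [hc, e]⟩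

theorem exists_normal_form (x : Cover k) : ∃ α β : k,
    ∃ x₁ ∈ ⨆ m, altSpan k (cg k) m, ∃ x₂ ∈ ⨆ m, altSpan k (cg k) m,
    ∃ x₃ ∈ ⨆ m, altSpan k (cg k) m, ∃ x₄ ∈ ⨆ m, altSpan k (cg k) m,
    x = α • 1 + β • cg k .A + x₁ + cg k .A * x₂ + x₃ * cg k .A + cg k .A * x₄ * cg k .A := by
  have hx : x ∈ (⊤ : Submodule k (Cover k)) := Submodule.mem_top
  rw [← cover_normal_eq_top, Submodule.one_eq_span] at hx
  obtain ⟨y4, hy4, z4, h4, e4⟩ := Submodule.mem_sup.1 hx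
  obtain ⟨y3, hy3, z3, h3, e3⟩ := Submodule.mem_sup.1 hy4
  obtain ⟨y2, hy2, z2, h2, e2⟩ := Submodule.mem_sup.1 hy3
  obtain ⟨y1, hy1, z1, h1, e1⟩ := Submodule.mem_sup.1 hy2
  obtain ⟨y0, hy0, z0, h0, e0⟩ := Submodule.mem_sup.1 hy1
  obtain ⟨α, eα⟩ := Submodule.mem_span_singleton.1 hy0
  obtain ⟨β, eβ⟩ := Submodule.mem_span_singleton.1 h0
  obtain ⟨x2, hx2, g2⟩ := Submodule.mem_span_singleton_mul.1 h2
  obtain ⟨x3, hx3, g3⟩ := Submodule.mem_mul_span_singleton.1 h3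
  obtain ⟨w4, hw4, g4⟩ := Submodule.mem_mul_span_singleton.1 h4
  obtain ⟨x4, hx4, f4⟩ := Submodule.mem_span_singleton_mul.1 hw4
  exact ⟨α, β, z1, h1, x2, hx2, x3, hx3, x4, hx4, by
    rw [eα, eβ, g2, g3, f4, g4, e0, e1, e2, e3, e4]⟩

theorem coverProj_dad : coverProj k (dad k) = 0 := by
  have := Presented.mk_of_mem (R := relators k) (x := monomial k [.D, .A, .D])
    (.inl (by simp [relators₀]))
  rw [Presented.mk_monomial] at this
  simpa only [dad, map_mul, coverProj_cg, List.map_cons, List.map_nil, List.prod_cons,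
    List.prod_nil, mul_one, mul_assoc] using this

/-- Lift to a normal form in `Cover` and drop the multiples of DAD, which vanish in the presented
algebra. Separation makes each of the four alternating parts act as zero, and faithfulness makes
them zero. -/
theorem presentedOp_injective [CharP k 2] : Function.Injective (presentedOp k) := by
  rw [injective_iff_map_eq_zero]
  intro x hx
  obtain ⟨y, rfl⟩ := coverProj_surjective x
  obtain ⟨α, β, x₁, h₁, x₂, h₂, x₃, h₃, x₄, h₄, rfl⟩ := exists_normal_form y
  obtain ⟨d₁, y₁, hy₁, c₁, rfl⟩ := exists_of_mem_iSup_altSpan h₁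
  obtain ⟨d₂, y₂, hy₂, c₂, rfl⟩ := exists_of_mem_iSup_altSpan h₂
  obtain ⟨d₃, y₃, hy₃, c₃, rfl⟩ := exists_of_mem_iSup_altSpan h₃
  obtain ⟨d₄, y₄, hy₄, c₄, rfl⟩ := exists_of_mem_iSup_altSpan h₄
  have m₁ := redSpan_mono (k := k) (show d₁ ≤ d₁ + d₂ + d₃ + d₄ by omega) hy₁
  have m₂ := redSpan_mono (k := k) (show d₂ ≤ d₁ + d₂ + d₃ + d₄ by omega) hy₂
  have m₃ := redSpan_mono (k := k) (show d₃ ≤ d₁ + d₂ + d₃ + d₄ by omega) hy₃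
  have m₄ := redSpan_mono (k := k) (show d₄ ≤ d₁ + d₂ + d₃ + d₄ by omega) hy₄
  have hd := coverProj_dad (k := k)
  simp only [map_add, map_mul, map_smul, map_one, hd, smul_zero, add_zero] at hx ⊢
  have hc : ∀ z, presentedOp k (coverProj k z) = coverOp k z := fun _ => rfl
  simp only [hc, coverOp_cg] at hx
  obtain ⟨rfl, rfl, e₁, e₂, e₃, e₄⟩ := isSeparated_opSpan (k := k) (d₁ + d₂ + d₃ + d₄) α β
    _ ⟨y₁, m₁, rfl⟩ _ ⟨y₂, m₂, rfl⟩ _ ⟨y₃, m₃, rfl⟩ _ ⟨y₄, m₄, rfl⟩ hx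
  obtain rfl := coverOp_eq_zero _ m₁ e₁
  obtain rfl := coverOp_eq_zero _ m₂ e₂
  obtain rfl := coverOp_eq_zero _ m₃ e₃
  obtain rfl := coverOp_eq_zero _ m₄ e₄
  simp

/-! ### The presentation of the tree enveloping algebra -/

theorem of_mul (g h : group) : treeEnvelopingAlgebra.of k group (g * h) =
    treeEnvelopingAlgebra.of k group g * treeEnvelopingAlgebra.of k group h :=
  Subtype.ext (map_mul (boundaryRep k group) g h)

theorem of_one : treeEnvelopingAlgebra.of k group 1 = 1 :=
  Subtype.ext (map_one (boundaryRep k group))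

theorem of_mem_adjoin (g : group) :
    treeEnvelopingAlgebra.of k group g ∈ Algebra.adjoin k (Set.range (gen k)) := by
  obtain ⟨g, hg⟩ := g
  have hs : ∀ s : Letter,
      treeEnvelopingAlgebra.of k group (groupGen s) ∈ Algebra.adjoin k (Set.range (gen k)) := by
    intro s
    have : treeEnvelopingAlgebra.of k group (groupGen s) = gen k s + 1 := by simp [gen]
    rw [this]
    exact add_mem (Algebra.subset_adjoin ⟨s, rfl⟩) (one_mem _)
  induction hg using Subgroup.closure_induction'' with
  | mem x hx =>
    obtain ⟨s, rfl⟩ := hx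
    exact hs s
  -- The generators are involutions.
  | inv_mem x hx =>
    obtain ⟨s, rfl⟩ := hx
    have : (⟨(s.state.perm)⁻¹, group.inv_mem (groupGen s).2⟩ : group) = groupGen s := by
      apply Subtype.ext
      ext ξ : 1
      rfl
    exact this ▸ hs s
  | one => exact of_one (k := k) ▸ one_mem _
  | mul x y hx hy h1 h2 =>
    exact of_mul (k := k) ⟨x, hx⟩ ⟨y, hy⟩ ▸ mul_mem h1 h2

theorem adjoin_gen_eq_top : Algebra.adjoin k (Set.range (gen k)) = ⊤ := by
  rw [eq_top_iff]
  rintro ⟨x, f, rfl⟩ -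
  induction f using MonoidAlgebra.induction_on with
  | of g =>
    have : (⟨(boundaryRep k group).asAlgebraHom (MonoidAlgebra.of k _ g), _, rfl⟩ :
        treeEnvelopingAlgebra k group) = treeEnvelopingAlgebra.of k group g :=
      Subtype.ext (Representation.asAlgebraHom_of _ g)
    exact this ▸ of_mem_adjoin g
  | add f g hf hg =>
    convert add_mem hf hg
    exact Subtype.ext (map_add (boundaryRep k group).asAlgebraHom f g)
  | smul r f hf =>
    convert Subalgebra.smul_mem _ hf r
    exact Subtype.ext (map_smul (boundaryRep k group).asAlgebraHom r f)

variable (k) in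
/-- The homomorphism from the free algebra to the tree enveloping algebra. -/
def freeEnveloping : FreeAlgebra k Letter →ₐ[k] treeEnvelopingAlgebra k group :=
  FreeAlgebra.lift k (gen k)

theorem coe_freeEnveloping (x : FreeAlgebra k Letter) :
    (freeEnveloping k x : Module.End k (BoundarySpace k)) = freeOp k x := by
  have : (treeEnvelopingAlgebra k group).val.comp (freeEnveloping k) = freeOp k := by
    apply FreeAlgebra.hom_ext
    funext s
    simp [freeEnveloping, freeOp, op]
  exact DFunLike.congr_fun this x

variable (k) in
/-- The homomorphism from the presented algebra to the tree enveloping algebra. -/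
def presentedEnveloping [CharP k 2] :
    Presented k (relators k) →ₐ[k] treeEnvelopingAlgebra k group :=
  Presented.lift (freeEnveloping k) fun x hx => Subtype.ext (by
    rw [coe_freeEnveloping, freeOp_of_mem_relators hx]; rfl)

theorem presentedEnveloping_gen [CharP k 2] (s : Letter) :
    presentedEnveloping k (Presented.gen k (relators k) s) = gen k s := by
  rw [← Presented.mk_ι, presentedEnveloping, Presented.lift_mk, freeEnveloping,
    FreeAlgebra.lift_ι_apply]

theorem presentedEnveloping_bijective [CharP k 2] :
    Function.Bijective (presentedEnveloping k) := by
  constructor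
  · intro x y h
    apply presentedOp_injective
    have e : ∀ x, presentedOp k x = presentedEnveloping k x := by
      intro x
      obtain ⟨x, rfl⟩ := Presented.mk_surjective x
      rw [presentedOp, presentedEnveloping, Presented.lift_mk, Presented.lift_mk,
        coe_freeEnveloping]
    rw [e, e, h]
  · rw [← AlgHom.range_eq_top, eq_top_iff, ← adjoin_gen_eq_top, Algebra.adjoin_le_iff]
    rintro _ ⟨s, rfl⟩
    exact ⟨_, presentedEnveloping_gen s⟩

variable (k) in
/-- The presentation of the tree enveloping algebra of the Grigorchuk group. -/
def presentation [CharP k 2] : Presented k (relators k) ≃ₐ[k] treeEnvelopingAlgebra k group :=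
  AlgEquiv.ofBijective (presentedEnveloping k) presentedEnveloping_bijective

theorem presentation_gen [CharP k 2] (s : Letter) :
    presentation k (Presented.gen k (relators k) s) = gen k s :=
  presentedEnveloping_gen s

/-! ### The set of relators is decidable -/

instance : Finite Letter := Finite.of_equiv _ Letter.equivFin.symm

theorem primrec_sigma : Primrec sigma :=
  Primrec.list_flatMap Primrec.id ((Primrec.dom_finite sigmaLetter).comp Primrec.snd).to₂

/-- Each application of σ replaces some A by ACA and shortens nothing, so the length grows at every
step. -/
theorem lt_length_sigma_iterate (n : ℕ) (w : List Letter) (hw : .A ∈ w) :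
    n < (sigma^[n] w).length := by
  have h1 : ∀ w, w.length ≤ (sigma w).length := by
    intro w
    induction w with
    | nil => simp
    | cons s w ih =>
      simp only [sigma, List.flatMap_cons, List.length_append, List.length_cons] at ih ⊢
      have : 1 ≤ (sigmaLetter s).length := by cases s <;> simp [sigmaLetter]
      omega
  have h2 : ∀ w, Letter.A ∈ w → w.length < (sigma w).length ∧ Letter.A ∈ sigma w := by
    intro w hw
    obtain ⟨u, v, rfl⟩ := List.append_of_mem hw
    have hu := h1 u
    have hv := h1 v
    simp only [sigma, List.flatMap_append, List.flatMap_cons, List.length_append,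
      List.length_cons] at hu hv ⊢
    refine ⟨?_, by simp [sigmaLetter]⟩
    have hA : (sigmaLetter .A).length = 3 := rfl
    omega
  suffices h : n < (sigma^[n] w).length ∧ Letter.A ∈ sigma^[n] w from h.1
  induction n with
  | zero => exact ⟨List.length_pos_of_mem hw, hw⟩
  | succ n ih =>
    rw [Function.iterate_succ_apply']
    obtain ⟨h3, h4⟩ := h2 _ ih.2
    exact ⟨by omega, h4⟩

/-- The length of the word bounds n, so a bounded, primitive recursive search decides membership. -/
theorem computablePred_sigmaRelators :
    ComputablePred (fun w : List Letter => w ∈ sigmaRelators) := by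
  apply PrimrecPred.computablePred
  have hi : ∀ w₀ : List Letter, Primrec fun n : ℕ => sigma^[n] w₀ := fun w₀ =>
    Primrec.nat_iterate Primrec.id (Primrec.const w₀) (primrec_sigma.comp Primrec.snd).to₂
  have hr : PrimrecRel fun (n : ℕ) (w : List Letter) =>
      w = sigma^[n] [.C, .A, .C, .A, .C, .A, .C] ∨ w = sigma^[n] [.D, .A, .C, .A, .C, .A, .D] :=
    ((Primrec.eq.comp Primrec.snd ((hi _).comp Primrec.fst)).or
      (Primrec.eq.comp Primrec.snd ((hi _).comp Primrec.fst)))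
  have hb : PrimrecPred fun w : List Letter => ∃ n ∈ List.range w.length,
      w = sigma^[n] [.C, .A, .C, .A, .C, .A, .C] ∨ w = sigma^[n] [.D, .A, .C, .A, .C, .A, .D] :=
    hr.exists_mem_list.comp (Primrec.list_range.comp Primrec.list_length) Primrec.id
  refine hb.of_eq fun w => ⟨?_, ?_⟩
  · rintro ⟨n, -, h⟩
    exact ⟨n, h⟩
  · rintro ⟨n, h⟩
    refine ⟨n, List.mem_range.2 ?_, h⟩
    rcases h with rfl | rfl <;> exact lt_length_sigma_iterate n _ (by simp)

/-! ### The grading -/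

section Grading
variable {W : Type*} [Ring W] [Algebra k W]

-- The coefficient of X^n is the projection to degree n.
open Polynomial in
theorem IsDegreeHom.iSupIndep {g : Letter → W} {Δ : W →ₐ[k] W[X]} (h : IsDegreeHom g Δ) :
    iSupIndep (wordSpan k g) := by
  intro n
  rw [Submodule.disjoint_def]
  intro x hx hx'
  have h1 : (Δ x).coeff n = x := by rw [h.apply_of_mem hx, coeff_C_mul_X_pow, if_pos rfl]
  have h2 : (⨆ j, ⨆ (_ : j ≠ n), wordSpan k g j) ≤
      LinearMap.ker ((lcoeff W n).restrictScalars k ∘ₗ Δ.toLinearMap) := by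
    refine iSup₂_le fun j hj y hy => ?_
    change (Δ y).coeff n = 0
    rw [h.apply_of_mem hy, coeff_C_mul_X_pow, if_neg hj.symm]
  exact h1.symm.trans (h2 hx')

theorem iSup_wordSpan_eq_top {g : Letter → W} (hg : Algebra.adjoin k (Set.range g) = ⊤) :
    ⨆ n, wordSpan k g n = ⊤ := by
  rw [eq_top_iff]
  intro x _
  have hx : x ∈ Algebra.adjoin k (Set.range g) := hg ▸ Algebra.mem_top
  have h1 : (1 : W) ∈ wordSpan k g 0 := Submodule.subset_span ⟨[], rfl, rfl⟩
  induction hx using Algebra.adjoin_induction with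
  | mem x hx =>
    obtain ⟨s, rfl⟩ := hx
    exact Submodule.mem_iSup_of_mem 1 (gen_mem_wordSpan g s)
  | algebraMap r =>
    rw [Algebra.algebraMap_eq_smul_one]
    exact Submodule.mem_iSup_of_mem 0 (Submodule.smul_mem _ _ h1)
  | add x y _ _ hx hy => exact add_mem (hx trivial) (hy trivial)
  | mul x y _ _ hx hy =>
    have h : (⨆ n, wordSpan k g n) * (⨆ n, wordSpan k g n) ≤ ⨆ n, wordSpan k g n := by
      simp only [Submodule.iSup_mul, Submodule.mul_iSup]
      exact iSup_le fun i => iSup_le fun j => le_iSup_of_le _ (wordSpan_mul_le g _ _)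
    exact h (Submodule.mul_mem_mul (hx trivial) (hy trivial))

theorem restrictScalars_pow_eq {g : Letter → W} (hg : Algebra.adjoin k (Set.range g) = ⊤)
    (ε : W →ₐ[k] k) (hε : ∀ s, ε (g s) = 0) (n : ℕ) :
    ((RingHom.ker ε : Ideal W) ^ n).restrictScalars k = ⨆ m ≥ n, wordSpan k g m := by
  have hmul : ∀ i j : ℕ, (⨆ m ≥ i, wordSpan k g m) * (⨆ m ≥ j, wordSpan k g m) ≤
      ⨆ m ≥ i + j, wordSpan k g m := by
    intro i j
    simp only [Submodule.iSup_mul, Submodule.mul_iSup]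
    exact iSup₂_le fun a ha => iSup₂_le fun b hb =>
      le_iSup₂_of_le (b + a) (by omega) (wordSpan_mul_le g _ _)
  have htop : (⨆ m ≥ 0, wordSpan k g m) = ⊤ := by
    rw [← iSup_wordSpan_eq_top hg]; simp
  -- Words of positive length have augmentation 0, so ε x is the constant term of x.
  have hker : ∀ x, ε x = 0 → x ∈ ⨆ m ≥ 1, wordSpan k g m := by
    intro x hx
    have hle : (⨆ m, wordSpan k g m) ≤ Submodule.span k {1} ⊔ ⨆ m ≥ 1, wordSpan k g m := by
      refine iSup_le fun m => ?_
      cases m with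
      | zero =>
        refine le_sup_of_le_left (Submodule.span_le.2 ?_)
        rintro _ ⟨w, hw, rfl⟩
        obtain rfl := List.length_eq_zero_iff.1 hw
        exact Submodule.mem_span_singleton_self _
      | succ m => exact le_sup_of_le_right (le_iSup₂_of_le (m + 1) (by omega) le_rfl)
    have hzero : (⨆ m ≥ 1, wordSpan k g m) ≤ LinearMap.ker ε.toLinearMap := by
      refine iSup₂_le fun m hm => Submodule.span_le.2 ?_
      rintro _ ⟨w, rfl, rfl⟩
      cases w with
      | nil => simp at hm
      | cons s w => simp [hε]
    rw [iSup_wordSpan_eq_top hg] at hle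
    obtain ⟨y, hy, z, hz, rfl⟩ := Submodule.mem_sup.1 (hle (Submodule.mem_top (x := x)))
    obtain ⟨c, rfl⟩ := Submodule.mem_span_singleton.1 hy
    have hz' : ε z = 0 := hzero hz
    have hc : c = 0 := by simpa [hz'] using hx
    simpa [hc] using hz
  induction n with
  | zero =>
    rw [htop, Submodule.pow_zero, Ideal.one_eq_top, Submodule.restrictScalars_top]
  | succ n ih =>
    rw [Submodule.pow_succ]
    apply le_antisymm
    · intro x (hx : x ∈ (RingHom.ker ε : Ideal W) ^ n • (RingHom.ker ε : Ideal W))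
      refine Submodule.smul_induction_on hx (fun a ha b hb => ?_) fun _ _ => add_mem
      have ha' : a ∈ ((RingHom.ker ε : Ideal W) ^ n).restrictScalars k := ha
      rw [ih] at ha'
      exact hmul n 1 (Submodule.mul_mem_mul ha' (hker b hb))
    -- Split off the last letter: it lies in the ideal, and the rest lies in its n-th power by
    -- induction.
    · refine iSup₂_le fun m hm => Submodule.span_le.2 ?_
      rintro _ ⟨w, rfl, rfl⟩
      obtain rfl | ⟨v, s, rfl⟩ := List.eq_nil_or_concat w
      · simp at hm
      · simp only [List.concat_eq_append, List.length_append, List.length_singleton] at hm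
        simp only [List.concat_eq_append, List.map_append, List.map_singleton, List.prod_append,
          List.prod_singleton]
        refine Ideal.mul_mem_mul (I := (RingHom.ker ε : Ideal W) ^ n) ?_ (hε s)
        have : (v.map g).prod ∈ ((RingHom.ker ε : Ideal W) ^ n).restrictScalars k := by
          rw [ih]
          exact Submodule.mem_iSup_of_mem v.length (Submodule.mem_iSup_of_mem (by omega)
            (Submodule.subset_span ⟨v, rfl, rfl⟩))
        exact this

end Grading

theorem isGradedAlongPowers_degreePart [CharP k 2] :
    IsGradedAlongPowers (degreePart k) (augmentationIdeal k group) where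
  one_mem := Submodule.subset_span ⟨[], rfl, rfl⟩
  mul_mem i j x y hx hy := wordSpan_mul_le (gen k) i j (Submodule.mul_mem_mul hx hy)
  isInternal := by
    obtain ⟨Δ, hΔ⟩ := Presented.exists_isDegreeHom (R := relators k)
      fun _ => exists_wordSpan_of_mem_relators
    refine DirectSum.isInternal_submodule_of_iSupIndep_of_iSup_eq_top ?_
      (iSup_wordSpan_eq_top adjoin_gen_eq_top)
    -- The degree homomorphism is transported from the presented algebra through the isomorphism.
    refine IsDegreeHom.iSupIndep (Δ := (Polynomial.mapAlgHom (presentedEnveloping k)).comp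
      (Δ.comp (presentation k).symm.toAlgHom)) fun s => ?_
    have h : (presentation k).symm (gen k s) = Presented.gen k (relators k) s := by
      rw [AlgEquiv.symm_apply_eq, presentation_gen]
    change Polynomial.mapAlgHom (presentedEnveloping k) (Δ ((presentation k).symm (gen k s))) = _
    rw [h, hΔ s]
    simp [presentedEnveloping_gen]
  pow_eq n := restrictScalars_pow_eq adjoin_gen_eq_top (augmentation k group)
    (fun s => by rw [gen, map_sub, augmentation_of, map_one, sub_self]) n

end Grigorchuk

end

theorem mainTheorem2 (k : Type*) [Field k] [CharP k 2] :
    (∃ e : Grigorchuk.Presented k (Grigorchuk.relators k) ≃ₐ[k]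
        treeEnvelopingAlgebra k Grigorchuk.group,
      ∀ s : Grigorchuk.Letter,
        e (Grigorchuk.Presented.gen k (Grigorchuk.relators k) s) = Grigorchuk.gen k s) ∧
    ComputablePred (fun w : List Grigorchuk.Letter => w ∈ Grigorchuk.sigmaRelators) ∧
    IsGradedAlongPowers (Grigorchuk.degreePart k)
      (augmentationIdeal k Grigorchuk.group) :=
  ⟨⟨Grigorchuk.presentation k, Grigorchuk.presentation_gen⟩,
    Grigorchuk.computablePred_sigmaRelators, Grigorchuk.isGradedAlongPowers_degreePart⟩
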